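/- Let $Z$ be a Banach space, $d\ge 1$, $\sigma\ge 0$, $0<\beta\le 1$. Let $C_{\rm u}(\mathbb{R}^{d},Z)$ be the Banach space of bounded uniformly continuous functions $\mathbb{R}^d\to Z$ with the supremum norm. Let $q\ge 1$, let $\gamma_1,\dots,\gamma_q\in\mathbb{R}^d$ be linearly independent, and let $\Gamma=\{n_1\gamma_1+\dots+n_q\gamma_q: n_j\in\mathbb{Z}\}$. Let $C_{\rm u}(\mathbb{R}^{d}/\Gamma,Z)$ be the subspace of functions $u\in C_{\rm u}(\mathbb{R}^{d},Z)$ with $u(x+\gamma)=u(x)$ for all $x\in\mathbb{R}^d$, $\gamma\in\Gamma$, let $C_0(\mathbb{R}^d,Z)$ be the space of continuous functions that tend to $0$ as $|x|\to\infty$, and let $X_{\Gamma,Z}=C_{\rm u}(\mathbb{R}^{d}/\Gamma,Z)\oplus C_{0}(\mathbb{R}^{d},Z)\subset C_{\rm u}(\mathbb{R}^{d},Z)$. Let $F:[0,\infty)\times Z\to Z$ be continuous and locally Lipschitz in the second variable: for all $R,T>0$ there is $L>0$ with $|F(t,z)-F(t,\tilde z)|_Z\le L|z-\tilde z|_Z$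 whenever $t\in[0,T]$ and $|z|_Z,|\tilde z|_Z\le R$. For $\sigma t>0$ put $\mathsf{S}(t)f=G_{\sigma,\beta}(t,\cdot)*f$, where $G_{\sigma,\beta}(t,x)=(\sigma t)^{-d/(2\beta)}g_\beta((\sigma t)^{-1/(2\beta)}x)$ and $g_\beta$ is the function with $\int_{\mathbb{R}^d} e^{-ix\cdot\xi}g_\beta(x)\,dx=e^{-|\xi|^{2\beta}}$; put $\mathsf{S}(t)f=f$ if $\sigma t=0$. For $T\in[0,\infty]$, a mild solution on $[0,T)$ of $\partial_t u+\sigma(-\Delta)^\beta u=N(t,x,u)$ with initial data $u_0\in C_{\rm u}(\mathbb{R}^{d},Z)$ is a function $u\in C([0,T),C_{\rm u}(\mathbb{R}^{d},Z))$ such that, for $0\le t<T$, $$u(t)=\mathsf{S}(t)u_0+\int_0^t\mathsf{S}(t-t')N(t',\cdot,u(t'))\,dt',$$ the integral being taken at each point $x\in\mathbb{R}^d$ (as a Bochner integral in $Z$). Let $T^*(u_0)$ be the supremum of the $T$ for which there is a mild solution on $[0,T)$ with initial data $u_0$ and nonlinearity $F(t,u)$. **Theorem.** Let $u_0\in X_{\Gamma,Z}$.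 Then $T^*(u_0)>0$, and there is a mild solution $u$ on $[0,T^*(u_0))$ with nonlinearity $F(t,u)$ and initial data $u_0$; every mild solution on an interval $[0,T)$ with the same nonlinearity and data coincides with $u$ there. It satisfies $u(t)\in X_{\Gamma,Z}$ for $0\le t<T^*(u_0)$. Moreover, if $u_0=v_0+w_0$ with $v_0\in C_{\rm u}(\mathbb{R}^{d}/\Gamma,Z)$ and $w_0\in C_0(\mathbb{R}^d,Z)$, then $T^*(u_0)\le T^*(v_0)$ and $u(t)=v(t)+w(t)$ for $0\le t<T^*(u_0)$, where * $v$ is the (likewise unique) mild solution on $[0,T^*(v_0))$ with nonlinearity $F(t,v)$ and initial data $v_0$, and $v(t)\in C_{\rm u}(\mathbb{R}^{d}/\Gamma,Z)$ for $0\le t<T^*(v_0)$; * $w$ satisfies $w(t)\in C_0(\mathbb{R}^d,Z)$ for $0\le t<T^*(u_0)$ and is a mild solution on $[0,T^*(u_0))$ with initial data $w_0$ and nonlinearity $F(t,v+w)-F(t,v)$, that is, $$w(t)=\mathsf{S}(t)w_0+\int_0^t\mathsf{S}(t-t')\bigl(F(t',v(t')+w(t'))-F(t',v(t'))\bigr)\,dt';$$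 every mild solution of this $w$-problem on an interval $[0,T)$ with $T\le T^*(u_0)$ coincides with $w$ there. -/

import Mathlib

open Set Filter Topology MeasureTheory
open scoped ENNReal FourierTransform BoundedContinuousFunction

noncomputable section

namespace FracRD

/-- The space `ℝᵈ` with its Euclidean norm and Lebesgue measure. -/
abbrev E (d : ℕ) : Type := EuclideanSpace ℝ (Fin d)

section Spaces

variable (d : ℕ) (Z : Type*) [NormedAddCommGroup Z] [NormedSpace ℝ Z]

/-- `C_u(ℝᵈ, Z)`: bounded uniformly continuous functions, as a subspace of the bounded
continuous functions with the supremum norm. -/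
def Cu : Submodule ℝ (E d →ᵇ Z) where
  carrier := {f | UniformContinuous f}
  add_mem' := fun {f g} hf hg => UniformContinuous.add (f := ⇑f) (g := ⇑g) hf hg
  zero_mem' := uniformContinuous_const
  smul_mem' := fun c f hf => UniformContinuous.const_smul (f := ⇑f) hf c

/-- `C_0(ℝᵈ, Z)`: continuous functions that tend to `0` as `|x| → ∞`. -/
def CZero : Submodule ℝ (E d →ᵇ Z) where
  carrier := {f | Tendsto f (cocompact (E d)) (𝓝 0)}
  add_mem' := fun {f g} hf hg => by
    have h := Tendsto.add (f := ⇑f) (g := ⇑g) hf hg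
    rw [add_zero] at h
    exact h
  zero_mem' := tendsto_const_nhds
  smul_mem' := fun c f hf => by
    have h := Tendsto.const_smul (f := ⇑f) hf c
    rw [smul_zero] at h
    exact h

variable {d}

/-- The lattice `Γ` of integer combinations of the vectors `γ j`. -/
def lattice {q : ℕ} (γ : Fin q → E d) : Submodule ℤ (E d) :=
  Submodule.span ℤ (range γ)

/-- `C_u(ℝᵈ/Γ, Z)`: the `Γ`-periodic functions of `C_u(ℝᵈ, Z)`. -/
def CuPer (Γ : Submodule ℤ (E d)) : Submodule ℝ (E d →ᵇ Z) where
  carrier := {f | f ∈ Cu d Z ∧ ∀ g ∈ Γ, ∀ x, f (x + g) = f x}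
  add_mem' := fun {f g} hf hg =>
    ⟨(Cu d Z).add_mem hf.1 hg.1, fun a ha x => by
      simp [hf.2 a ha x, hg.2 a ha x]⟩
  zero_mem' := ⟨(Cu d Z).zero_mem, fun _ _ _ => rfl⟩
  smul_mem' := fun c f hf =>
    ⟨(Cu d Z).smul_mem c hf.1, fun a ha x => by simp [hf.2 a ha x]⟩

/-- `X_{Γ,Z} = C_u(ℝᵈ/Γ, Z) ⊕ C_0(ℝᵈ, Z)`. -/
def XSpace (Γ : Submodule ℤ (E d)) : Submodule ℝ (E d →ᵇ Z) :=
  CuPer Z Γ ⊔ CZero d Z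

/-- The sum in `XSpace` is direct as soon as `Γ ≠ 0`. -/
theorem disjoint_cuPer_cZero (Γ : Submodule ℤ (E d)) (hΓ : Γ ≠ ⊥) :
    Disjoint (CuPer Z Γ) (CZero d Z) := by
  rw [Submodule.disjoint_def]
  intro f hf h0
  obtain ⟨g, hg, hg0⟩ := Submodule.exists_mem_ne_zero_of_ne_bot hΓ
  ext x
  have h1 : Tendsto (fun n : ℕ => x + (n : ℤ) • g) atTop (cocompact (E d)) := by
    rw [← Metric.cobounded_eq_cocompact]
    refine (_root_.tendsto_const_add_cobounded x).comp ?_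
    rw [← tendsto_norm_atTop_iff_cobounded]
    have h2 : ∀ n : ℕ, ‖(n : ℤ) • g‖ = (n : ℝ) * ‖g‖ := fun n => by
      rw [← Int.cast_smul_eq_zsmul ℝ, norm_smul]; simp
    simp_rw [h2]
    exact tendsto_natCast_atTop_atTop.atTop_mul_const (norm_pos_iff.mpr hg0)
  have h3 : Tendsto (fun n : ℕ => f (x + (n : ℤ) • g)) atTop (𝓝 0) := Tendsto.comp h0 h1
  have h4 : ∀ n : ℕ, f (x + (n : ℤ) • g) = f x := fun n =>
    hf.2 _ (Γ.smul_mem _ hg) x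
  simp_rw [h4] at h3
  exact tendsto_nhds_unique tendsto_const_nhds h3

end Spaces

section Semigroup

variable {d : ℕ} {Z : Type*} [NormedAddCommGroup Z] [NormedSpace ℝ Z]

/-- The function `g_β` on `ℝᵈ` with `∫ e^{-i x·ξ} g_β(x) dx = e^{-|ξ|^{2β}}`, written as the inverse
Fourier transform. Mathlib's character is `e^{2πi x·ξ}`, which is why `2π` appears; the imaginary
part vanishes since the symbol is even. -/
def gKernel (β : ℝ) (x : E d) : ℝ :=
  (𝓕⁻ (fun ξ : E d => (Real.exp (-(2 * Real.pi * ‖ξ‖) ^ (2 * β)) : ℂ)) x).re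

/-- `G_{σ,β}(t, x) = (σt)^{-d/(2β)} g_β((σt)^{-1/(2β)} x)`. -/
def GKernel (σ β t : ℝ) (x : E d) : ℝ :=
  (σ * t) ^ (-(d : ℝ) / (2 * β)) * gKernel β ((σ * t) ^ (-1 / (2 * β)) • x)

/-- `S(t) f = G_{σ,β}(t, ·) * f`, the semigroup generated by `-σ(-Δ)^β`;
it is the identity if `t = 0` or `σ = 0`. -/
def S (σ β t : ℝ) (f : E d → Z) : E d → Z :=
  open scoped Classical in
  if σ * t = 0 then f else fun x => ∫ y, GKernel σ β t y • f (x - y)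

end Semigroup

section Mild

variable {d : ℕ} {Z : Type*} [NormedAddCommGroup Z] [NormedSpace ℝ Z]

/-- `F : ℝ₊ × Z → Z` is locally Lipschitz in the second variable (values of `F` at negative times
are never used). -/
def LocallyLipschitzSnd (F : ℝ → Z → Z) : Prop :=
  ∀ R > 0, ∀ T > 0, ∃ L > 0, ∀ t ∈ Icc (0 : ℝ) T, ∀ z z' : Z, ‖z‖ ≤ R → ‖z'‖ ≤ R →
    ‖F t z - F t z'‖ ≤ L * ‖z - z'‖

/-- The time interval `[0, T)`, where `T ∈ [0, ∞]`. -/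
def timeInterval (T : ℝ≥0∞) : Set ℝ := {t | 0 ≤ t ∧ ENNReal.ofReal t < T}

/-- `u ∈ C([0,T), C_u(ℝᵈ, Z))` is a mild solution of `∂ₜu + σ(-Δ)^β u = N(t, x, u)`,
`u(0) = u₀`, that is, `u(t) = S(t)u₀ + ∫₀ᵗ S(t-s) N(s, ·, u(s)) ds` on `[0,T)`.
The identity between functions of `x` is read at each `x ∈ ℝᵈ`, with a Bochner integral in `Z`.
(When `s ↦ S(t-s) N(s, ·, u(s))` is Bochner integrable in `C_u(ℝᵈ, Z)`, this is the same as the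
identity in `C_u(ℝᵈ, Z)`, as evaluation at `x` is a continuous linear map.) -/
structure IsMildSolution (σ β : ℝ) (N : ℝ → E d → Z → Z) (u₀ : E d →ᵇ Z) (T : ℝ≥0∞)
    (u : ℝ → E d →ᵇ Z) : Prop where
  mem_Cu : ∀ t ∈ timeInterval T, u t ∈ Cu d Z
  continuousOn : ContinuousOn u (timeInterval T)
  integrable : ∀ t ∈ timeInterval T, ∀ x,
    IntervalIntegrable (fun s => S σ β (t - s) (fun y => N s y (u s y)) x) volume 0 t
  mild : ∀ t ∈ timeInterval T, ∀ x,
    u t x = S σ β t u₀ x + ∫ s in (0 : ℝ)..t, S σ β (t - s) (fun y => N s y (u s y)) x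

/-- The maximal time of existence `T*(u₀) ∈ [0, ∞]` for the nonlinearity `F(t, u)`. -/
def maxTime (σ β : ℝ) (F : ℝ → Z → Z) (u₀ : E d →ᵇ Z) : ℝ≥0∞ :=
  sSup {T | ∃ u, IsMildSolution σ β (fun t _ z => F t z) u₀ T u}

end Mild

end FracRD

end

open Set Filter Topology MeasureTheory
open scoped ENNReal FourierTransform BoundedContinuousFunction

noncomputable section

namespace FracRD

/-! ### Functions with nonnegative cosine transform; mixtures of Gaussians -/

section Kernel

variable {d : ℕ}

/-! The function g_β is a probability density, so `S σ β t` averages a function over translates at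
spatial scale (σt)^{1/(2β)}. Such averages do not increase the sup norm, and they preserve uniform
continuity, periods and decay at infinity. Positivity of g_β for β < 1 comes from writing |ξ|^{2β}
as a positive mixture of the functions 1 - e^{-l|ξ|²}. Once the mixture is truncated near l = 0, the
symbol becomes a positive constant times the exponential of a mixture of Gaussians, and every term
of that power series has a nonnegative transform (`posType_symbol`). The total mass is the value of
the symbol at 0 (`integral_gKernel`).

When `F` is cut off in time and in size, Picard iteration converges on every interval [0,T]
(`IsTame.exists_picard`). Started from zero, the iterates for periodic data stay periodic, and the
iterates for two data differing by an element of C_0 keep differing by elements of C_0. Both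
properties survive the limit (`IsVolterra.mem_CuPer`, `IsVolterra.sub_mem_CZero`). A mild solution
is bounded on compact time intervals, so it solves a cut-off equation there; this gives uniqueness,
and gluing gives the maximal solution.

The lifespans are compared at infinity: along a period a, u(t, x + na) tends to v(t, x), hence
‖v(t)‖ ≤ ‖u(t)‖ (`norm_le_of_sub_mem_CZero`). A cutoff that is inactive for u is therefore inactive
for v, and v lives at least as long as u. Finally w is u - v, and its uniqueness follows from that
of u by adding v. -/

theorem integrable_gaussian {ε : ℝ} (hε : 0 < ε) :
    Integrable (fun ξ : E d => Real.exp (-ε * ‖ξ‖ ^ 2)) := by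
  have h := (GaussianFourier.integrable_cexp_neg_mul_sq_norm_add (V := E d) (b := (ε : ℂ))
    (by simpa using hε) 0 0).re
  refine h.congr (Eventually.of_forall fun ξ => ?_)
  have : (-(ε : ℂ) * (‖ξ‖ : ℂ) ^ 2 + 0 * ((inner ℝ (0 : E d) ξ : ℝ) : ℂ))
      = ((-ε * ‖ξ‖ ^ 2 : ℝ) : ℂ) := by push_cast; ring
  simp only [this]
  exact Complex.exp_ofReal_re _

theorem integral_gaussian_mul_cos {ε : ℝ} (hε : 0 < ε) (x : E d) :
    ∫ ξ : E d, Real.exp (-ε * ‖ξ‖ ^ 2) * Real.cos (2 * Real.pi * inner ℝ x ξ)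
      = (Real.pi / ε) ^ ((d : ℝ) / 2) * Real.exp (-(Real.pi ^ 2 / ε) * ‖x‖ ^ 2) := by
  have hb : 0 < (ε : ℂ).re := by simpa using hε
  have h1 := GaussianFourier.integrable_cexp_neg_mul_sq_norm_add (V := E d) hb
    (2 * Real.pi * Complex.I) x
  have h2 := GaussianFourier.integral_cexp_neg_mul_sq_norm_add (V := E d) hb
    (2 * Real.pi * Complex.I) x
  have h3 := Complex.reCLM.integral_comp_comm h1
  rw [h2] at h3
  have h4 : ∀ ξ : E d, Complex.reCLM (Complex.exp (-(ε : ℂ) * (‖ξ‖ : ℂ) ^ 2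
      + 2 * Real.pi * Complex.I * ((inner ℝ x ξ : ℝ) : ℂ)))
      = Real.exp (-ε * ‖ξ‖ ^ 2) * Real.cos (2 * Real.pi * inner ℝ x ξ) := by
    intro ξ
    simp only [Complex.reCLM_apply]
    rw [Complex.exp_re]
    congr 2 <;> simp [← Complex.ofReal_pow]
  simp_rw [h4] at h3
  rw [h3, Complex.reCLM_apply]
  have h5 : ((Real.pi : ℂ) / (ε : ℂ)) ^ ((Module.finrank ℝ (E d) : ℂ) / 2)
      * Complex.exp ((2 * Real.pi * Complex.I) ^ 2 * (‖x‖ : ℂ) ^ 2 / (4 * (ε : ℂ)))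
      = (((Real.pi / ε) ^ ((d : ℝ) / 2) * Real.exp (-(Real.pi ^ 2 / ε) * ‖x‖ ^ 2) : ℝ) : ℂ) := by
    rw [Complex.ofReal_mul, Complex.ofReal_cpow (by positivity), Complex.ofReal_exp]
    congr 1
    · simp
    · congr 1
      have : (ε : ℂ) ≠ 0 := by exact_mod_cast hε.ne'
      push_cast
      field_simp
      rw [Complex.I_sq]; ring
  rw [h5, Complex.ofReal_re]

/-- Bounded functions whose product with every centred Gaussian has a nonnegative cosine
transform. -/
def PosType (p : E d → ℝ) : Prop :=
  Measurable p ∧ (∃ C, ∀ ξ, |p ξ| ≤ C) ∧ ∀ ε > 0, ∀ x : E d,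
    0 ≤ ∫ ξ, p ξ * (Real.exp (-ε * ‖ξ‖ ^ 2) * Real.cos (2 * Real.pi * inner ℝ x ξ))

theorem integrable_mul_gaussian_mul_cos {p : E d → ℝ} (hp : Measurable p) {C : ℝ}
    (hC : ∀ ξ, |p ξ| ≤ C) {ε : ℝ} (hε : 0 < ε) (x : E d) :
    Integrable fun ξ =>
      p ξ * (Real.exp (-ε * ‖ξ‖ ^ 2) * Real.cos (2 * Real.pi * inner ℝ x ξ)) := by
  refine ((integrable_gaussian hε).bdd_mul (f := fun ξ => p ξ *
    Real.cos (2 * Real.pi * inner ℝ x ξ)) (c := C) ?_ ?_).congr ?_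
  · exact (hp.mul (by fun_prop)).aestronglyMeasurable
  · refine Eventually.of_forall fun ξ => ?_
    rw [norm_mul]
    exact (mul_le_of_le_one_right (norm_nonneg _) (Real.abs_cos_le_one _)).trans (hC ξ)
  · exact Eventually.of_forall fun ξ => by ring

theorem PosType.one : PosType (fun _ : E d => 1) := by
  refine ⟨measurable_const, ⟨1, by simp⟩, fun ε hε x => ?_⟩
  simp_rw [one_mul]
  rw [integral_gaussian_mul_cos hε]
  positivity

theorem PosType.add {p q : E d → ℝ} (hp : PosType p) (hq : PosType q) :
    PosType (fun ξ => p ξ + q ξ) := by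
  obtain ⟨hpm, ⟨C, hC⟩, hp⟩ := hp
  obtain ⟨hqm, ⟨D, hD⟩, hq⟩ := hq
  refine ⟨hpm.add hqm, ⟨C + D, fun ξ => (abs_add_le _ _).trans (add_le_add (hC ξ) (hD ξ))⟩,
    fun ε hε x => ?_⟩
  simp_rw [add_mul]
  rw [integral_add (integrable_mul_gaussian_mul_cos hpm hC hε x)
    (integrable_mul_gaussian_mul_cos hqm hD hε x)]
  exact add_nonneg (hp ε hε x) (hq ε hε x)

theorem PosType.const_mul {p : E d → ℝ} (hp : PosType p) {c : ℝ} (hc : 0 ≤ c) :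
    PosType (fun ξ => c * p ξ) := by
  obtain ⟨hpm, ⟨C, hC⟩, hp⟩ := hp
  refine ⟨hpm.const_mul c, ⟨c * C, fun ξ => ?_⟩, fun ε hε x => ?_⟩
  · rw [abs_mul, abs_of_nonneg hc]
    exact mul_le_mul_of_nonneg_left (hC ξ) hc
  · simp_rw [mul_assoc c]
    rw [integral_const_mul]
    exact mul_nonneg hc (hp ε hε x)

/-- The Gaussian built into `PosType` supplies an integrable majorant, so a uniform bound on the
sequence is enough for dominated convergence. -/
theorem PosType.of_tendsto {p : ℕ → E d → ℝ} (hp : ∀ n, PosType (p n)) {q : E d → ℝ} {C : ℝ}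
    (hC : ∀ n ξ, |p n ξ| ≤ C) (hq : ∀ ξ, Tendsto (fun n => p n ξ) atTop (𝓝 (q ξ))) :
    PosType q := by
  refine ⟨measurable_of_tendsto_metrizable (fun n => (hp n).1) (tendsto_pi_nhds.2 hq),
    ⟨C, fun ξ => le_of_tendsto (hq ξ).abs (Eventually.of_forall fun n => hC n ξ)⟩,
    fun ε hε x => ?_⟩
  refine ge_of_tendsto' (tendsto_integral_of_dominated_convergence
    (fun ξ => C * Real.exp (-ε * ‖ξ‖ ^ 2))
    (fun n => (integrable_mul_gaussian_mul_cos (hp n).1 (hC n) hε x).aestronglyMeasurable)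
    ((integrable_gaussian hε).const_mul C) (fun n => Eventually.of_forall fun ξ => ?_)
    (Eventually.of_forall fun ξ => (hq ξ).mul_const _)) (fun n => (hp n).2.2 ε hε x)
  rw [Real.norm_eq_abs, abs_mul, abs_mul, Real.abs_exp]
  exact mul_le_mul (hC n ξ) (mul_le_of_le_one_right (Real.exp_nonneg _) (Real.abs_cos_le_one _))
    (by positivity) ((abs_nonneg _).trans (hC n ξ))

/-- The new factor merges with the test Gaussian, whose parameter becomes `c + ε`. -/
theorem PosType.comp_gaussian_mul {p : E d → ℝ} (hp : PosType p) {c : ℝ} (hc : 0 ≤ c) :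
    PosType (fun ξ => Real.exp (-c * ‖ξ‖ ^ 2) * p ξ) := by
  obtain ⟨hpm, ⟨C, hC⟩, hp⟩ := hp
  refine ⟨by fun_prop, ⟨C, fun ξ => ?_⟩, fun ε hε x => ?_⟩
  · rw [abs_mul, Real.abs_exp]
    refine (mul_le_of_le_one_left (abs_nonneg _) (Real.exp_le_one_iff.2 ?_)).trans (hC ξ)
    have := mul_nonneg hc (sq_nonneg ‖ξ‖)
    linarith
  · convert hp (c + ε) (by linarith) x using 3 with ξ
    rw [show -(c + ε) * ‖ξ‖ ^ 2 = -c * ‖ξ‖ ^ 2 + -ε * ‖ξ‖ ^ 2 by ring, Real.exp_add]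
    ring

/-- Mixtures of centred Gaussians. -/
def gaussMix (s : Set ℝ) (k : ℝ → ℝ) (ξ : E d) : ℝ :=
  ∫ l in s, k l * Real.exp (-l * ‖ξ‖ ^ 2)

theorem integrableOn_gaussMix {s : Set ℝ} (hs : s ⊆ Ici 0) (hsm : MeasurableSet s) {k : ℝ → ℝ}
    (hk : IntegrableOn k s) (ξ : E d) :
    IntegrableOn (fun l => k l * Real.exp (-l * ‖ξ‖ ^ 2)) s := by
  refine Integrable.mul_bdd (c := 1) hk (by fun_prop) ?_
  refine (ae_restrict_iff' hsm).2 (Eventually.of_forall fun l hl => ?_)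
  rw [Real.norm_eq_abs, Real.abs_exp]
  exact Real.exp_le_one_iff.2 (by have := mul_nonneg (hs hl) (sq_nonneg ‖ξ‖); linarith)

theorem abs_gaussMix_le {s : Set ℝ} (hs : s ⊆ Ici 0) (hsm : MeasurableSet s) {k : ℝ → ℝ}
    (hk : IntegrableOn k s) (hk0 : ∀ l ∈ s, 0 ≤ k l) (ξ : E d) :
    |gaussMix s k ξ| ≤ ∫ l in s, k l := by
  rw [gaussMix, abs_of_nonneg]
  · refine setIntegral_mono_on (integrableOn_gaussMix hs hsm hk ξ) hk hsm fun l hl => ?_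
    refine mul_le_of_le_one_right (hk0 l hl) (Real.exp_le_one_iff.2 ?_)
    have := mul_nonneg (hs hl) (sq_nonneg ‖ξ‖)
    linarith
  · exact setIntegral_nonneg hsm fun l hl => mul_nonneg (hk0 l hl) (Real.exp_nonneg _)

theorem measurable_gaussMix {s : Set ℝ} (hs : s ⊆ Ici 0) (hsm : MeasurableSet s) {k : ℝ → ℝ}
    (hk : IntegrableOn k s) : Measurable (gaussMix (d := d) s k) := by
  refine Continuous.measurable ?_
  refine continuous_of_dominated (bound := fun l => |k l|)
    (fun ξ => (integrableOn_gaussMix hs hsm hk ξ).aestronglyMeasurable) (fun ξ => ?_)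
    hk.abs (Eventually.of_forall fun l => by fun_prop)
  refine (ae_restrict_iff' hsm).2 (Eventually.of_forall fun l hl => ?_)
  rw [Real.norm_eq_abs, abs_mul, Real.abs_exp]
  refine mul_le_of_le_one_right (abs_nonneg _) (Real.exp_le_one_iff.2 ?_)
  have := mul_nonneg (hs hl) (sq_nonneg ‖ξ‖)
  linarith

/-- By Fubini the mixing integral can be taken last; for each fixed `l` this is
`PosType.comp_gaussian_mul`. -/
theorem PosType.gaussMix_mul {p : E d → ℝ} (hp : PosType p) {s : Set ℝ} (hs : s ⊆ Ici 0)
    (hsm : MeasurableSet s) {k : ℝ → ℝ} (hk : IntegrableOn k s) (hk0 : ∀ l ∈ s, 0 ≤ k l) :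
    PosType (fun ξ => gaussMix s k ξ * p ξ) := by
  obtain ⟨C, hC⟩ := hp.2.1
  refine ⟨(measurable_gaussMix hs hsm hk).mul hp.1, ⟨(∫ l in s, k l) * C, fun ξ => ?_⟩,
    fun ε hε x => ?_⟩
  · rw [abs_mul]
    exact mul_le_mul (abs_gaussMix_le hs hsm hk hk0 ξ) (hC ξ) (abs_nonneg _)
      (setIntegral_nonneg hsm hk0)
  · have h1 : ∀ ξ, gaussMix s k ξ * p ξ *
        (Real.exp (-ε * ‖ξ‖ ^ 2) * Real.cos (2 * Real.pi * inner ℝ x ξ)) =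
        ∫ l in s, k l * (Real.exp (-l * ‖ξ‖ ^ 2) * p ξ *
          (Real.exp (-ε * ‖ξ‖ ^ 2) * Real.cos (2 * Real.pi * inner ℝ x ξ))) := by
      intro ξ
      rw [gaussMix, mul_assoc, ← integral_mul_const]
      congr 1 with l
      ring
    simp_rw [h1]
    rw [integral_integral_swap]
    · refine setIntegral_nonneg hsm fun l hl => ?_
      rw [integral_const_mul]
      exact mul_nonneg (hk0 l hl) ((hp.comp_gaussian_mul (hs hl)).2.2 ε hε x)
    · have h2 : Integrable (fun z : E d × ℝ => (p z.1 * (Real.exp (-ε * ‖z.1‖ ^ 2) *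
          Real.cos (2 * Real.pi * inner ℝ x z.1))) * k z.2)
          (volume.prod (volume.restrict s)) :=
        (integrable_mul_gaussian_mul_cos hp.1 hC hε x).mul_prod hk
      refine (h2.bdd_mul (f := fun z : E d × ℝ => Real.exp (-z.2 * ‖z.1‖ ^ 2)) (c := 1)
        (by fun_prop) ?_).congr (Eventually.of_forall fun z => ?_)
      · have : ∀ᵐ z ∂(volume : Measure (E d)).prod (volume.restrict s), z.2 ∈ s := by
          have h := ae_restrict_mem (μ := (volume : Measure ℝ)) hsm
          exact Measure.quasiMeasurePreserving_snd.ae h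
        filter_upwards [this] with z hz
        rw [Real.norm_eq_abs, Real.abs_exp]
        refine Real.exp_le_one_iff.2 ?_
        have := mul_nonneg (hs hz) (sq_nonneg ‖z.1‖)
        linarith
      · simp only [Function.uncurry]
        ring

/-- Powers of the mixture are handled by `PosType.gaussMix_mul`, and the partial sums of the
exponential series are bounded by the exponential of the total mass. -/
theorem PosType.exp_gaussMix {s : Set ℝ} (hs : s ⊆ Ici 0)
    (hsm : MeasurableSet s) {k : ℝ → ℝ} (hk : IntegrableOn k s) (hk0 : ∀ l ∈ s, 0 ≤ k l) :
    PosType (fun ξ : E d => Real.exp (gaussMix s k ξ)) := by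
  have hpow : ∀ n : ℕ, PosType (fun ξ : E d => gaussMix s k ξ ^ n) := by
    intro n
    induction n with
    | zero => simpa using PosType.one
    | succ n ih => simpa only [pow_succ'] using ih.gaussMix_mul hs hsm hk hk0
  have hsum : ∀ n : ℕ, PosType (fun ξ : E d =>
      ∑ i ∈ Finset.range n, gaussMix s k ξ ^ i / (i.factorial : ℝ)) := by
    intro n
    induction n with
    | zero => simpa using PosType.one.const_mul le_rfl
    | succ n ih =>
      simp_rw [Finset.sum_range_succ, div_eq_inv_mul] at ih ⊢
      exact ih.add ((hpow n).const_mul (by positivity))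
  refine PosType.of_tendsto hsum (C := Real.exp (∫ l in s, k l)) (fun n ξ => ?_) fun ξ => ?_
  · refine (Finset.abs_sum_le_sum_abs _ _).trans ?_
    refine le_trans (Finset.sum_le_sum fun i _ => ?_)
      (Real.sum_le_exp_of_nonneg (setIntegral_nonneg hsm hk0) n)
    rw [abs_div, abs_pow, Nat.abs_cast]
    gcongr
    exact abs_gaussMix_le hs hsm hk hk0 ξ
  · rw [Real.exp_eq_exp_ℝ]
    exact (NormedSpace.expSeries_div_hasSum_exp (gaussMix s k ξ)).tendsto_sum_nat

end Kernel

/-! ### The kernel g_β is a probability density -/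

section StableKernel

/-- Near 0 the bound 1 - e^{-l} ≤ l leaves l^{-β}, which needs β < 1; near infinity l^{-1-β} needs β
> 0. -/
theorem integrableOn_rpow_mul_one_sub_exp {β : ℝ} (hβ : 0 < β) (hβ' : β < 1) :
    IntegrableOn (fun l : ℝ => l ^ (-1 - β) * (1 - Real.exp (-l))) (Ioi 0) := by
  have hm : Measurable (fun l : ℝ => l ^ (-1 - β) * (1 - Real.exp (-l))) := by fun_prop
  rw [← Ioc_union_Ioi_eq_Ioi zero_le_one]
  refine IntegrableOn.union ?_ ?_
  · have h : IntegrableOn (fun l : ℝ => l ^ (-β)) (Ioc 0 1) :=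
      (intervalIntegral.intervalIntegrable_rpow' (a := 0) (b := 1) (r := -β) (by linarith)).1
    refine Integrable.mono' h hm.aestronglyMeasurable ?_
    refine (ae_restrict_iff' measurableSet_Ioc).2 (Eventually.of_forall fun l hl => ?_)
    have h1 : 0 ≤ 1 - Real.exp (-l) := by
      have := Real.exp_le_one_iff.2 (neg_nonpos.2 hl.1.le); linarith
    have h2 : 1 - Real.exp (-l) ≤ l := by have := Real.add_one_le_exp (-l); linarith
    rw [norm_mul, Real.norm_of_nonneg (Real.rpow_nonneg hl.1.le _), Real.norm_of_nonneg h1]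
    calc l ^ (-1 - β) * (1 - Real.exp (-l)) ≤ l ^ (-1 - β) * l :=
          mul_le_mul_of_nonneg_left h2 (Real.rpow_nonneg hl.1.le _)
      _ = l ^ (-β) := by
          rw [← Real.rpow_add_one hl.1.ne']; congr 1; ring
  · have h : IntegrableOn (fun l : ℝ => l ^ (-1 - β)) (Ioi 1) :=
      integrableOn_Ioi_rpow_of_lt (by linarith) one_pos
    refine Integrable.mono' h hm.aestronglyMeasurable ?_
    refine (ae_restrict_iff' measurableSet_Ioi).2 (Eventually.of_forall fun l hl => ?_)
    have hl0 : 0 < l := one_pos.trans hl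
    have h1 : 0 ≤ 1 - Real.exp (-l) := by
      have := Real.exp_le_one_iff.2 (neg_nonpos.2 hl0.le); linarith
    rw [norm_mul, Real.norm_of_nonneg (Real.rpow_nonneg hl0.le _), Real.norm_of_nonneg h1]
    refine mul_le_of_le_one_right (Real.rpow_nonneg hl0.le _) ?_
    have := Real.exp_pos (-l); linarith

theorem integral_rpow_mul_one_sub_exp_pos {β : ℝ} (hβ : 0 < β) (hβ' : β < 1) :
    0 < ∫ l in Ioi (0 : ℝ), l ^ (-1 - β) * (1 - Real.exp (-l)) := by
  have hpos : ∀ l ∈ Ioi (0 : ℝ), 0 < l ^ (-1 - β) * (1 - Real.exp (-l)) := fun l hl =>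
    mul_pos (Real.rpow_pos_of_pos hl _)
      (sub_pos.2 (Real.exp_lt_one_iff.2 (neg_neg_of_pos (mem_Ioi.1 hl))))
  rw [setIntegral_pos_iff_support_of_nonneg_ae
    ((ae_restrict_iff' measurableSet_Ioi).2 (Eventually.of_forall fun l hl => (hpos l hl).le))
    (integrableOn_rpow_mul_one_sub_exp hβ hβ')]
  have : Function.support (fun l : ℝ => l ^ (-1 - β) * (1 - Real.exp (-l))) ∩ Ioi 0 = Ioi 0 :=
    inter_eq_right.2 fun l hl => (hpos l hl).ne'
  rw [this]
  simp

/-- Scaling in `l`. With s = |ξ|² it represents |ξ|^{2β}, up to a constant, as a mixture of the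
functions 1 - e^{-l|ξ|²}. -/
theorem integral_rpow_mul_one_sub_exp_mul {β s : ℝ} (hs : 0 < s) :
    ∫ l in Ioi (0 : ℝ), l ^ (-1 - β) * (1 - Real.exp (-l * s))
      = s ^ β * ∫ l in Ioi (0 : ℝ), l ^ (-1 - β) * (1 - Real.exp (-l)) := by
  have h := integral_comp_mul_left_Ioi
    (fun l : ℝ => l ^ (-1 - β) * (1 - Real.exp (-l))) 0 hs
  rw [mul_zero, smul_eq_mul] at h
  have h2 : ∫ l in Ioi (0 : ℝ), (s * l) ^ (-1 - β) * (1 - Real.exp (-(s * l)))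
      = s ^ (-1 - β) * ∫ l in Ioi (0 : ℝ), l ^ (-1 - β) * (1 - Real.exp (-l * s)) := by
    rw [← integral_const_mul]
    refine setIntegral_congr_fun measurableSet_Ioi fun l hl => ?_
    rw [Real.mul_rpow hs.le (le_of_lt hl), mul_assoc]
    congr 4
    ring
  rw [h2] at h
  have h3 : s ^ (1 + β) * s ^ (-1 - β) = 1 := by
    rw [← Real.rpow_add hs]; simp
  have h4 : s ^ β = s ^ (1 + β) * s⁻¹ := by
    rw [← Real.rpow_neg_one, ← Real.rpow_add hs]; congr 1; ring
  rw [h4, mul_assoc, ← h, ← mul_assoc, h3, one_mul]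

variable {d : ℕ}

/-- The weight l^{-1-β} is not integrable at 0, so the exponent cannot be split directly. On (δ, ∞)
it splits into a constant and a Gaussian mixture, and `PosType.exp_gaussMix` applies; then δ tends
to 0. -/
theorem posType_exp_neg_mul_rpow {β a : ℝ} (hβ : 0 < β) (hβ' : β < 1) (ha : 0 ≤ a) :
    PosType (fun ξ : E d => Real.exp
      (-(a * ∫ l in Ioi (0 : ℝ), l ^ (-1 - β) * (1 - Real.exp (-l * ‖ξ‖ ^ 2))))) := by
  set k : ℝ → ℝ := fun l => a * l ^ (-1 - β) with hk
  set δ : ℕ → ℝ := fun n => 1 / ((n : ℝ) + 1) with hδ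
  have hδ0 : ∀ n, 0 < δ n := fun n => Nat.one_div_pos_of_nat
  have hki : ∀ n, IntegrableOn k (Ioi (δ n)) := fun n =>
    (integrableOn_Ioi_rpow_of_lt (by linarith) (hδ0 n)).const_mul a
  have hsub : ∀ n, Ioi (δ n) ⊆ Ici 0 := fun n l hl => ((hδ0 n).trans hl).le
  have hk0 : ∀ n, ∀ l ∈ Ioi (δ n), 0 ≤ k l := fun n l hl =>
    mul_nonneg ha (Real.rpow_nonneg (hsub n hl) _)
  have hint : ∀ ξ : E d, IntegrableOn
      (fun l : ℝ => l ^ (-1 - β) * (1 - Real.exp (-l * ‖ξ‖ ^ 2))) (Ioi 0) := by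
    intro ξ
    rcases eq_or_ne ξ 0 with rfl | hξ
    · simp
    · have hs : 0 < ‖ξ‖ ^ 2 := by positivity
      have h := (integrableOn_Ioi_comp_mul_left_iff
        (fun l : ℝ => l ^ (-1 - β) * (1 - Real.exp (-l))) 0 hs).2
        (by rw [mul_zero]; exact integrableOn_rpow_mul_one_sub_exp hβ hβ')
      refine (IntegrableOn.congr_fun (h.const_mul (((‖ξ‖ ^ 2) ^ (-1 - β))⁻¹)) (fun l hl => ?_)
        measurableSet_Ioi)
      have h3 : (‖ξ‖ ^ 2) ^ (-1 - β) ≠ 0 := (Real.rpow_pos_of_pos hs _).ne'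
      rw [Real.mul_rpow hs.le (le_of_lt hl), mul_assoc, inv_mul_cancel_left₀ h3]
      congr 4
      ring
  have heq : ∀ n, ∀ ξ : E d, Real.exp (-(∫ l in Ioi (δ n), k l)) *
      Real.exp (gaussMix (Ioi (δ n)) k ξ) = Real.exp (-(a * ∫ l in Ioi (δ n),
        l ^ (-1 - β) * (1 - Real.exp (-l * ‖ξ‖ ^ 2)))) := by
    intro n ξ
    rw [← Real.exp_add, gaussMix, ← integral_const_mul, neg_add_eq_sub, ← neg_sub,
      ← integral_sub (hki n) (integrableOn_gaussMix (hsub n) measurableSet_Ioi (hki n) ξ)]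
    congr 3 with l
    simp only [hk]
    ring
  refine PosType.of_tendsto (p := fun n ξ => Real.exp (-(∫ l in Ioi (δ n), k l)) *
      Real.exp (gaussMix (Ioi (δ n)) k ξ)) (C := 1)
    (fun n => (PosType.exp_gaussMix (hsub n) measurableSet_Ioi (hki n) (hk0 n)).const_mul
      (Real.exp_nonneg _)) (fun n ξ => ?_) fun ξ => ?_
  · rw [heq, Real.abs_exp]
    refine Real.exp_le_one_iff.2 (neg_nonpos.2 (mul_nonneg ha
      (setIntegral_nonneg measurableSet_Ioi fun l hl => mul_nonneg
        (Real.rpow_nonneg (hsub n hl) _) ?_)))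
    have h1 := mul_nonneg (hsub n hl) (sq_nonneg ‖ξ‖)
    have := Real.exp_le_one_iff.2 (show -l * ‖ξ‖ ^ 2 ≤ 0 by linarith)
    linarith
  · simp_rw [heq]
    refine ((Real.continuous_exp.tendsto _).comp (Tendsto.neg (Tendsto.const_mul a ?_)))
    have hcov := aecover_Ioi_of_Ioi (μ := (volume : Measure ℝ)) (A := 0)
      (tendsto_one_div_add_atTop_nhds_zero_nat (𝕜 := ℝ))
    have h := hcov.integral_tendsto_of_countably_generated (hint ξ)
    refine h.congr fun n => ?_
    rw [Measure.restrict_restrict measurableSet_Ioi]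
    congr 2
    exact inter_eq_left.2 (Ioi_subset_Ioi (hδ0 n).le)

theorem posType_symbol {β : ℝ} (hβ : 0 < β) (hβ' : β ≤ 1) :
    PosType (fun ξ : E d => Real.exp (-(2 * Real.pi * ‖ξ‖) ^ (2 * β))) := by
  have hpi : 0 ≤ 2 * Real.pi := by positivity
  rcases hβ'.lt_or_eq with hlt | rfl
  · have hK := integral_rpow_mul_one_sub_exp_pos hβ hlt
    set K := ∫ l in Ioi (0 : ℝ), l ^ (-1 - β) * (1 - Real.exp (-l)) with hKdef
    -- Dividing by `K` normalises the mixture so that the exponent is exactly the symbol. For β = 1,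
    -- treated below, the symbol is itself a Gaussian.
    convert posType_exp_neg_mul_rpow (d := d) hβ hlt
      (a := (2 * Real.pi) ^ (2 * β) / K) (by positivity) using 4 with ξ
    rcases eq_or_ne ξ 0 with rfl | hξ
    · simp [hβ.ne']
    · have hs : 0 < ‖ξ‖ ^ 2 := by positivity
      rw [integral_rpow_mul_one_sub_exp_mul hs, ← hKdef, Real.mul_rpow hpi (norm_nonneg _),
        Real.rpow_mul (norm_nonneg ξ), Real.rpow_two]
      field_simp
  · convert PosType.one.comp_gaussian_mul (d := d) (c := (2 * Real.pi) ^ 2) (by positivity)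
      using 2 with ξ
    rw [mul_one, mul_one, Real.rpow_two]
    ring_nf

theorem integrable_symbol [NeZero d] {β : ℝ} (hβ : 0 < β) :
    Integrable (fun ξ : E d => Real.exp (-(2 * Real.pi * ‖ξ‖) ^ (2 * β))) := by
  have : Nontrivial (E d) := Module.nontrivial_of_finrank_pos (R := ℝ)
    (by simpa using NeZero.pos d)
  rw [integrable_fun_norm_addHaar (volume : Measure (E d))
    (f := fun r => Real.exp (-(2 * Real.pi * r) ^ (2 * β)))]
  have h := integrableOn_rpow_mul_exp_neg_mul_rpow (p := 2 * β)
    (s := ((Module.finrank ℝ (E d) - 1 : ℕ) : ℝ)) (b := (2 * Real.pi) ^ (2 * β))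
    (by have : (0:ℝ) ≤ ((Module.finrank ℝ (E d) - 1 : ℕ) : ℝ) := Nat.cast_nonneg _
        linarith) (by positivity) (by positivity)
  refine h.congr_fun (fun r hr => ?_) measurableSet_Ioi
  simp only [smul_eq_mul, Real.rpow_natCast]
  rw [Real.mul_rpow (by positivity) (le_of_lt hr), neg_mul]

theorem gKernel_eq_integral [NeZero d] {β : ℝ} (hβ : 0 < β) (x : E d) :
    gKernel β x = ∫ ξ : E d, Real.exp (-(2 * Real.pi * ‖ξ‖) ^ (2 * β)) *
      Real.cos (2 * Real.pi * inner ℝ x ξ) := by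
  rw [gKernel, Real.fourierInv_eq']
  have hi : Integrable (fun v : E d => Complex.exp (((2 * Real.pi * inner ℝ v x : ℝ) : ℂ)
      * Complex.I) • (Real.exp (-(2 * Real.pi * ‖v‖) ^ (2 * β)) : ℂ)) := by
    refine Integrable.bdd_mul (c := 1) (integrable_symbol hβ).ofReal (by fun_prop) ?_
    exact Eventually.of_forall fun v => (Complex.norm_exp_ofReal_mul_I _).le
  have h := Complex.reCLM.integral_comp_comm hi
  rw [Complex.reCLM_apply] at h
  rw [← h]
  congr 1 with ξ
  rw [Complex.reCLM_apply, smul_eq_mul, Complex.re_mul_ofReal, Complex.exp_ofReal_mul_I_re,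
    mul_comm, real_inner_comm]

/-- The symbol is integrable, so the test Gaussian in `PosType` can be removed by letting its
parameter 1/(n+1) tend to 0. -/
theorem gKernel_nonneg [NeZero d] {β : ℝ} (hβ : 0 < β) (hβ' : β ≤ 1) (x : E d) :
    0 ≤ gKernel β x := by
  rw [gKernel_eq_integral hβ]
  have hp := posType_symbol (d := d) hβ hβ'
  refine ge_of_tendsto' (tendsto_integral_of_dominated_convergence
    (F := fun (n : ℕ) (ξ : E d) => Real.exp (-(2 * Real.pi * ‖ξ‖) ^ (2 * β)) *
      (Real.exp (-(1 / ((n : ℝ) + 1)) * ‖ξ‖ ^ 2) * Real.cos (2 * Real.pi * inner ℝ x ξ)))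
    (fun ξ : E d => Real.exp (-(2 * Real.pi * ‖ξ‖) ^ (2 * β)))
    (fun n => (hp.1.mul (by fun_prop)).aestronglyMeasurable)
    (integrable_symbol hβ) (fun n => Eventually.of_forall fun ξ => ?_)
    (Eventually.of_forall fun ξ => ?_)) (fun n => hp.2.2 _ Nat.one_div_pos_of_nat x)
  · rw [norm_mul, norm_mul, Real.norm_of_nonneg (Real.exp_nonneg _),
      Real.norm_of_nonneg (Real.exp_nonneg _)]
    refine mul_le_of_le_one_right (Real.exp_nonneg _)
      (mul_le_one₀ (Real.exp_le_one_iff.2 ?_) (norm_nonneg _) (Real.abs_cos_le_one _))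
    rw [neg_mul]
    exact neg_nonpos.2 (by positivity)
  · refine Tendsto.const_mul _ ?_
    have h1 : Tendsto (fun n : ℕ => Real.exp (-(1 / ((n : ℝ) + 1)) * ‖ξ‖ ^ 2)) atTop
        (𝓝 (Real.exp (-0 * ‖ξ‖ ^ 2))) :=
      (Real.continuous_exp.tendsto _).comp
        ((tendsto_one_div_add_atTop_nhds_zero_nat (𝕜 := ℝ)).neg.mul_const _)
    simpa using h1.mul_const (Real.cos (2 * Real.pi * inner ℝ x ξ))

theorem continuous_gKernel [NeZero d] {β : ℝ} (hβ : 0 < β) :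
    Continuous (gKernel (d := d) β) := by
  rw [funext (gKernel_eq_integral (d := d) hβ)]
  have hi := integrable_symbol (d := d) hβ
  refine continuous_of_dominated
    (fun x => hi.aestronglyMeasurable.mul (by fun_prop)) (fun x => ?_) hi
    (Eventually.of_forall fun ξ => by fun_prop)
  refine Eventually.of_forall fun ξ => ?_
  rw [norm_mul, Real.norm_of_nonneg (Real.exp_nonneg _)]
  exact mul_le_of_le_one_right (Real.exp_nonneg _) (Real.abs_cos_le_one _)

theorem abs_gKernel_le [NeZero d] {β : ℝ} (hβ : 0 < β) (x : E d) :
    |gKernel β x| ≤ ∫ ξ : E d, Real.exp (-(2 * Real.pi * ‖ξ‖) ^ (2 * β)) := by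
  rw [gKernel_eq_integral hβ]
  rw [← Real.norm_eq_abs]
  refine norm_integral_le_of_norm_le (integrable_symbol (d := d) hβ) (Eventually.of_forall fun ξ => ?_)
  rw [norm_mul, Real.norm_of_nonneg (Real.exp_nonneg _)]
  exact mul_le_of_le_one_right (Real.exp_nonneg _) (Real.abs_cos_le_one _)

/-- Pairing of the kernel with a Gaussian of width `1 / r`. -/
theorem integral_gKernel_mul_gaussian [NeZero d] {β : ℝ} (hβ : 0 < β) {r : ℝ} (hr : 0 < r) :
    ∫ x : E d, gKernel β x * Real.exp (-(Real.pi * r ^ 2) * ‖x‖ ^ 2) =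
      ∫ η : E d, Real.exp (-(2 * Real.pi * ‖r • η‖) ^ (2 * β)) *
        Real.exp (-Real.pi * ‖η‖ ^ 2) := by
  have hε : 0 < Real.pi * r ^ 2 := by positivity
  set φ : E d → ℝ := fun ξ => Real.exp (-(2 * Real.pi * ‖ξ‖) ^ (2 * β)) with hφ
  have hi : Integrable φ := integrable_symbol (d := d) hβ
  have h1 : ∀ x : E d, gKernel β x * Real.exp (-(Real.pi * r ^ 2) * ‖x‖ ^ 2) =
      ∫ ξ : E d, φ ξ *
        (Real.exp (-(Real.pi * r ^ 2) * ‖x‖ ^ 2) * Real.cos (2 * Real.pi * inner ℝ ξ x)) := by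
    intro x
    rw [gKernel_eq_integral hβ, ← integral_mul_const]
    congr 1 with ξ
    rw [real_inner_comm]
    ring
  simp_rw [h1]
  rw [integral_integral_swap]
  · simp_rw [integral_const_mul, integral_gaussian_mul_cos hε]
    -- Substitution ξ = rη: its Jacobian is the normalising factor of the Gaussian transform, as
    -- `h3` records.
    have h2 := Measure.integral_comp_smul (volume : Measure (E d))
      (fun ξ => φ ξ * Real.exp (-Real.pi * ‖r⁻¹ • ξ‖ ^ 2)) r
    simp_rw [smul_smul, inv_mul_cancel₀ hr.ne', one_smul] at h2
    rw [h2, smul_eq_mul, ← integral_const_mul]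
    congr 1 with ξ
    have h3 : (Real.pi / (Real.pi * r ^ 2)) ^ ((d : ℝ) / 2) =
        |(r ^ Module.finrank ℝ (E d))⁻¹| := by
      rw [finrank_euclideanSpace_fin, abs_of_pos (by positivity)]
      rw [show Real.pi / (Real.pi * r ^ 2) = (r⁻¹) ^ (2 : ℝ) by
        rw [Real.rpow_two]; field_simp]
      rw [← Real.rpow_mul (by positivity), mul_div_cancel₀ _ two_ne_zero, Real.rpow_natCast,
        inv_pow]
    have h4 : -(Real.pi ^ 2 / (Real.pi * r ^ 2)) * ‖ξ‖ ^ 2 = -Real.pi * (r⁻¹ * ‖ξ‖) ^ 2 := by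
      field_simp
    rw [h3, h4, norm_smul, Real.norm_of_nonneg (inv_pos.2 hr).le, mul_left_comm]
  · have h2 : Integrable (fun z : E d × E d =>
        Real.exp (-(Real.pi * r ^ 2) * ‖z.1‖ ^ 2) * φ z.2) (volume.prod volume) :=
      (integrable_gaussian hε).mul_prod hi
    refine (h2.bdd_mul (f := fun z : E d × E d => Real.cos (2 * Real.pi * inner ℝ z.2 z.1))
      (c := 1) (by fun_prop) (Eventually.of_forall fun z => Real.abs_cos_le_one _)).congr
      (Eventually.of_forall fun z => ?_)
    simp only [Function.uncurry]
    ring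

theorem integral_gaussian_pi : ∫ η : E d, Real.exp (-Real.pi * ‖η‖ ^ 2) = 1 := by
  rw [GaussianFourier.integral_rexp_neg_mul_sq_norm Real.pi_pos, div_self Real.pi_ne_zero,
    Real.one_rpow]

theorem symbol_le_one (β : ℝ) (ξ : E d) :
    Real.exp (-(2 * Real.pi * ‖ξ‖) ^ (2 * β)) ≤ 1 :=
  Real.exp_le_one_iff.2 (neg_nonpos.2 (by positivity))

/-- Since the symbol is at most 1, every Gaussian-weighted integral of the kernel is at most 1. The
kernel is nonnegative, so Fatou's lemma removes the weight. -/
theorem integrable_gKernel [NeZero d] {β : ℝ} (hβ : 0 < β) (hβ' : β ≤ 1) :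
    Integrable (gKernel (d := d) β) := by
  have hg0 := gKernel_nonneg (d := d) hβ hβ'
  have hgc := continuous_gKernel (d := d) hβ
  refine ⟨hgc.aestronglyMeasurable, ?_⟩
  rw [hasFiniteIntegral_iff_ofReal (Eventually.of_forall hg0)]
  set δ : ℕ → ℝ := fun n => 1 / ((n : ℝ) + 1) with hδ
  have hδ0 : ∀ n, 0 < δ n := fun n => Nat.one_div_pos_of_nat
  have hlim : ∀ x : E d, Tendsto
      (fun n => ENNReal.ofReal (gKernel β x * Real.exp (-(Real.pi * δ n ^ 2) * ‖x‖ ^ 2))) atTop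
      (𝓝 (ENNReal.ofReal (gKernel β x))) := by
    intro x
    refine (ENNReal.continuous_ofReal.tendsto _).comp ?_
    have h1 : Tendsto (fun n : ℕ => Real.exp (-(Real.pi * δ n ^ 2) * ‖x‖ ^ 2)) atTop
        (𝓝 (Real.exp (-(Real.pi * 0 ^ 2) * ‖x‖ ^ 2))) :=
      (Real.continuous_exp.tendsto _).comp
        ((((tendsto_one_div_add_atTop_nhds_zero_nat (𝕜 := ℝ)).pow 2).const_mul _).neg.mul_const _)
    simpa using h1.const_mul (gKernel β x)
  have hle : ∀ n, ∫⁻ x : E d,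
      ENNReal.ofReal (gKernel β x * Real.exp (-(Real.pi * δ n ^ 2) * ‖x‖ ^ 2)) ≤ 1 := by
    intro n
    have hint : Integrable (fun x : E d =>
        gKernel β x * Real.exp (-(Real.pi * δ n ^ 2) * ‖x‖ ^ 2)) :=
      (integrable_gaussian (by have := hδ0 n; positivity)).bdd_mul hgc.aestronglyMeasurable
        (Eventually.of_forall fun x => abs_gKernel_le hβ x)
    rw [← ofReal_integral_eq_lintegral_ofReal hint
      (Eventually.of_forall fun x => mul_nonneg (hg0 x) (Real.exp_nonneg _)),
      integral_gKernel_mul_gaussian hβ (hδ0 n), ← ENNReal.ofReal_one,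
      ← integral_gaussian_pi (d := d)]
    refine ENNReal.ofReal_le_ofReal (integral_mono_of_nonneg
      (Eventually.of_forall fun η => by positivity) (integrable_gaussian Real.pi_pos)
      (Eventually.of_forall fun η => ?_))
    exact mul_le_of_le_one_left (Real.exp_nonneg _) (symbol_le_one β _)
  calc ∫⁻ x : E d, ENNReal.ofReal (gKernel β x)
      = ∫⁻ x : E d, liminf (fun n => ENNReal.ofReal
          (gKernel β x * Real.exp (-(Real.pi * δ n ^ 2) * ‖x‖ ^ 2))) atTop := by
        simp_rw [fun x => (hlim x).liminf_eq]
    _ ≤ liminf (fun n => ∫⁻ x : E d, ENNReal.ofReal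
          (gKernel β x * Real.exp (-(Real.pi * δ n ^ 2) * ‖x‖ ^ 2))) atTop :=
        lintegral_liminf_le fun n => by
          have := hgc.measurable
          fun_prop
    _ ≤ liminf (fun _ : ℕ => (1 : ℝ≥0∞)) atTop :=
        liminf_le_liminf (Eventually.of_forall hle)
    _ < ⊤ := by simp

/-- Let r tend to 0 in `integral_gKernel_mul_gaussian`: the left side tends to the mass of the
kernel, the right side to a normalised Gaussian integral, because the symbol equals 1 at the origin.
-/
theorem integral_gKernel [NeZero d] {β : ℝ} (hβ : 0 < β) (hβ' : β ≤ 1) :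
    ∫ x : E d, gKernel β x = 1 := by
  have hgi := integrable_gKernel (d := d) hβ hβ'
  set δ : ℕ → ℝ := fun n => 1 / ((n : ℝ) + 1) with hδ
  have hδ0 : ∀ n, 0 < δ n := fun n => Nat.one_div_pos_of_nat
  have hδl : Tendsto δ atTop (𝓝 0) := tendsto_one_div_add_atTop_nhds_zero_nat
  have h1 : Tendsto (fun n => ∫ x : E d,
      gKernel β x * Real.exp (-(Real.pi * δ n ^ 2) * ‖x‖ ^ 2)) atTop
      (𝓝 (∫ x : E d, gKernel β x)) := by
    refine tendsto_integral_of_dominated_convergence (fun x => ‖gKernel β x‖)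
      (fun n => hgi.aestronglyMeasurable.mul (by fun_prop)) hgi.norm
      (fun n => Eventually.of_forall fun x => ?_) (Eventually.of_forall fun x => ?_)
    · rw [norm_mul, Real.norm_of_nonneg (Real.exp_nonneg _)]
      refine mul_le_of_le_one_right (norm_nonneg _) (Real.exp_le_one_iff.2 ?_)
      rw [neg_mul]
      exact neg_nonpos.2 (by positivity)
    · have h1 : Tendsto (fun n : ℕ => Real.exp (-(Real.pi * δ n ^ 2) * ‖x‖ ^ 2)) atTop
          (𝓝 (Real.exp (-(Real.pi * 0 ^ 2) * ‖x‖ ^ 2))) :=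
        (Real.continuous_exp.tendsto _).comp (((hδl.pow 2).const_mul _).neg.mul_const _)
      simpa using h1.const_mul (gKernel β x)
  have h2 : Tendsto (fun n => ∫ η : E d, Real.exp (-(2 * Real.pi * ‖δ n • η‖) ^ (2 * β)) *
        Real.exp (-Real.pi * ‖η‖ ^ 2)) atTop (𝓝 (∫ η : E d, Real.exp (-Real.pi * ‖η‖ ^ 2))) := by
    refine tendsto_integral_of_dominated_convergence _
      (fun n => Measurable.aestronglyMeasurable (by fun_prop))
      (integrable_gaussian Real.pi_pos)
      (fun n => Eventually.of_forall fun x => ?_) (Eventually.of_forall fun x => ?_)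
    · rw [Real.norm_of_nonneg (by positivity)]
      exact mul_le_of_le_one_left (Real.exp_nonneg _) (symbol_le_one β _)
    · have hc : Continuous fun r : ℝ => Real.exp (-(2 * Real.pi * ‖r • x‖) ^ (2 * β)) := by
        refine Real.continuous_exp.comp (Continuous.neg (Continuous.rpow_const (by fun_prop)
          fun r => Or.inr (by positivity)))
      have h := ((hc.tendsto 0).comp hδl).mul_const (Real.exp (-Real.pi * ‖x‖ ^ 2))
      simpa [Real.zero_rpow (show 2 * β ≠ 0 by positivity)] using h
  simp_rw [integral_gKernel_mul_gaussian (d := d) hβ (hδ0 _)] at h1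
  rw [tendsto_nhds_unique h1 h2, integral_gaussian_pi]

end StableKernel

/-! ### Averages of translates against a probability measure -/

section Average

variable {d : ℕ} {Z : Type*} [NormedAddCommGroup Z]

theorem integrable_avg {μ : Measure (E d)} [IsProbabilityMeasure μ] {f : E d → Z} (hf : Continuous f) {C : ℝ} (hC : ∀ x, ‖f x‖ ≤ C) (ρ : ℝ)
    (x : E d) : Integrable (fun y => f (x - ρ • y)) μ :=
  Integrable.of_bound (Continuous.aestronglyMeasurable (by fun_prop)) C
    (Eventually.of_forall fun _ => hC _)

variable [NormedSpace ℝ Z]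

/-- The average `∫ f(x - ρ y) dμ(y)`. -/
def avg (μ : Measure (E d)) (ρ : ℝ) (f : E d → Z) (x : E d) : Z := ∫ y, f (x - ρ • y) ∂μ

variable {μ : Measure (E d)}

theorem avg_add_period {f : E d → Z} {a : E d} (hf : ∀ x, f (x + a) = f x) (ρ : ℝ) (x : E d) :
    avg μ ρ f (x + a) = avg μ ρ f x := by
  simp only [avg]
  congr 1 with y
  rw [add_sub_right_comm, hf]

variable [IsProbabilityMeasure μ]

theorem norm_avg_le {f : E d → Z} {C : ℝ} (hC : ∀ x, ‖f x‖ ≤ C) (ρ : ℝ) (x : E d) :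
    ‖avg μ ρ f x‖ ≤ C := by
  simpa [avg] using norm_integral_le_of_norm_le_const (μ := μ)
    (Eventually.of_forall fun y => hC (x - ρ • y))

theorem avg_zero [CompleteSpace Z] (f : E d → Z) : avg μ 0 f = f := by
  ext x
  simp [avg]

theorem avg_sub {f g : E d → Z} (hf : Continuous f) (hg : Continuous g) {C D : ℝ}
    (hC : ∀ x, ‖f x‖ ≤ C) (hD : ∀ x, ‖g x‖ ≤ D) (ρ : ℝ) (x : E d) :
    avg μ ρ (fun y => f y - g y) x = avg μ ρ f x - avg μ ρ g x :=
  integral_sub (integrable_avg hf hC ρ x) (integrable_avg hg hD ρ x)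

theorem avg_add {f g : E d → Z} (hf : Continuous f) (hg : Continuous g) {C D : ℝ}
    (hC : ∀ x, ‖f x‖ ≤ C) (hD : ∀ x, ‖g x‖ ≤ D) (ρ : ℝ) (x : E d) :
    avg μ ρ (fun y => f y + g y) x = avg μ ρ f x + avg μ ρ g x :=
  integral_add (integrable_avg hf hC ρ x) (integrable_avg hg hD ρ x)

/-- The average of a family of functions with a common bound and a common modulus of continuity
is continuous in `(ρ, x)` uniformly over the family. -/
theorem exists_modulus_avg (μ : Measure (E d)) [IsProbabilityMeasure μ] {C ε δ : ℝ}
    (hε : 0 < ε) (hδ : 0 < δ) :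
    ∃ δ' > 0, ∀ f : E d → Z, Continuous f → (∀ x, ‖f x‖ ≤ C) →
      (∀ x x', dist x x' < δ → dist (f x) (f x') ≤ ε) →
      ∀ ρ ρ' x x', dist ρ ρ' < δ' → dist x x' < δ' →
        dist (avg μ ρ f x) (avg μ ρ' f x') ≤ 2 * ε := by
  -- Tightness: outside `K` the integrands differ by at most 2C, so this mass bound keeps the
  -- contribution of the tail below ε.
  obtain ⟨K, hK, hK'⟩ := isTightMeasureSet_iff_exists_isCompact_measure_compl_le.1
    (isTightMeasureSet_singleton (μ := μ)) (ENNReal.ofReal (ε / (2 * |C| + 1)))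
    (ENNReal.ofReal_pos.2 (by positivity))
  have hK' := hK' μ rfl
  obtain ⟨M, hM0, hM⟩ := hK.isBounded.exists_pos_norm_le
  -- For `y` in `K` the evaluation points move by at most dist x x' + M · dist ρ ρ', which this
  -- choice keeps below δ.
  refine ⟨δ / (1 + M), by positivity, fun f hf hC hmod ρ ρ' x x' hρ hx => ?_⟩
  rw [lt_div_iff₀ (by positivity)] at hρ hx
  have hC0 : 0 ≤ C := (norm_nonneg _).trans (hC x)
  have hKr : μ.real Kᶜ ≤ ε / (2 * |C| + 1) := ENNReal.toReal_le_of_le_ofReal (by positivity) hK'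
  rw [abs_of_nonneg hC0] at hKr
  have hmeas : MeasurableSet Kᶜ := hK.isClosed.measurableSet.compl
  rw [dist_eq_norm, avg, avg, ← integral_sub (integrable_avg hf hC ρ x)
    (integrable_avg hf hC ρ' x')]
  calc ‖∫ y, (f (x - ρ • y) - f (x' - ρ' • y)) ∂μ‖
      ≤ ∫ y, (ε + Kᶜ.indicator (fun _ => 2 * C) y) ∂μ := by
        refine norm_integral_le_of_norm_le
          ((integrable_const _).add ((integrable_const _).indicator hmeas))
          (Eventually.of_forall fun y => ?_)
        by_cases hy : y ∈ K
        · rw [indicator_of_notMem (by simpa using hy), add_zero, ← dist_eq_norm]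
          refine hmod _ _ ?_
          calc dist (x - ρ • y) (x' - ρ' • y) ≤ dist x x' + dist (ρ • y) (ρ' • y) :=
                dist_sub_sub_le _ _ _ _
            _ ≤ dist x x' + dist ρ ρ' * M := by
                gcongr
                rw [dist_eq_norm, ← sub_smul, norm_smul, ← dist_eq_norm]
                exact mul_le_mul_of_nonneg_left (hM y hy) dist_nonneg
            _ < δ := by
                have h1 : 0 ≤ dist ρ ρ' := dist_nonneg
                have h2 : 0 ≤ dist x x' := dist_nonneg
                rcases le_total (dist ρ ρ') (dist x x') with h | h
                · nlinarith
                · nlinarith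
        · rw [indicator_of_mem (by simpa using hy)]
          have := norm_sub_le (f (x - ρ • y)) (f (x' - ρ' • y))
          have h1 := hC (x - ρ • y)
          have h2 := hC (x' - ρ' • y)
          linarith
    _ = ε + μ.real Kᶜ * (2 * C) := by
        rw [integral_add (integrable_const _) ((integrable_const _).indicator hmeas),
          integral_indicator_const _ hmeas]
        simp
    _ ≤ ε + ε / (2 * C + 1) * (2 * C) := by gcongr
    _ ≤ 2 * ε := by
        have : ε / (2 * C + 1) * (2 * C) ≤ ε := by
          rw [div_mul_eq_mul_div, div_le_iff₀ (by positivity)]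
          nlinarith
        linarith

/-- Dominated convergence along a filter requires the filter to be countably generated. -/
theorem isCountablyGenerated_cocompact : (cocompact (E d)).IsCountablyGenerated := by
  rw [← Metric.cobounded_eq_cocompact, ← comap_norm_atTop]
  infer_instance

theorem tendsto_avg_cocompact {f : E d → Z} (hf : Continuous f) {C : ℝ} (hC : ∀ x, ‖f x‖ ≤ C)
    (h0 : Tendsto f (cocompact (E d)) (𝓝 0)) (ρ : ℝ) :
    Tendsto (avg μ ρ f) (cocompact (E d)) (𝓝 0) := by
  have := isCountablyGenerated_cocompact (d := d)
  have h : Tendsto (fun x => ∫ y, f (x - ρ • y) ∂μ) (cocompact (E d)) (𝓝 (∫ _, (0 : Z) ∂μ)) := by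
    refine tendsto_integral_filter_of_dominated_convergence (fun _ => C)
      (Eventually.of_forall fun x => (integrable_avg hf hC ρ x).aestronglyMeasurable)
      (Eventually.of_forall fun x => Eventually.of_forall fun y => hC _) (integrable_const _)
      (Eventually.of_forall fun y => ?_)
    exact h0.comp (Homeomorph.subRight (ρ • y)).isClosedEmbedding.tendsto_cocompact
  rwa [integral_zero] at h

end Average

/-! ### The Duhamel integral -/

section Duhamel

variable {d : ℕ} {Z : Type*} [NormedAddCommGroup Z] [NormedSpace ℝ Z]
  {μ : Measure (E d)} {r : ℝ → ℝ}

/-- The Duhamel term `∫₀ᵗ A(r(t-s)) f(s) ds`, where `A(ρ)` is the average at scale `ρ`. -/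
def duhamel (μ : Measure (E d)) (r : ℝ → ℝ) (f : ℝ → E d → Z) (t : ℝ) (x : E d) : Z :=
  ∫ s in (0 : ℝ)..t, avg μ (r (t - s)) (f s) x

theorem duhamel_add_period {f : ℝ → E d → Z} {a : E d} (hf : ∀ s x, f s (x + a) = f s x) (t : ℝ)
    (x : E d) : duhamel μ r f t (x + a) = duhamel μ r f t x := by
  simp only [duhamel]
  congr 1 with s
  exact avg_add_period (hf s) _ _

variable [IsProbabilityMeasure μ]

theorem continuous_avg_family (hr : Continuous r) {f : ℝ → E d → Z}
    (hf : Continuous (Function.uncurry f)) {C : ℝ} (hC : ∀ s x, ‖f s x‖ ≤ C) :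
    Continuous fun p : ℝ × ℝ × E d => avg μ (r p.1) (f p.2.1) p.2.2 := by
  refine continuous_of_dominated (bound := fun _ => C)
    (fun p => (integrable_avg (f := f p.2.1) (by fun_prop) (hC _) _ _).aestronglyMeasurable)
    (fun p => Eventually.of_forall fun y => hC _ _) (integrable_const _)
    (Eventually.of_forall fun y => ?_)
  exact hf.comp (f := fun p : ℝ × ℝ × E d => (p.2.1, p.2.2 - r p.1 • y)) (by fun_prop)

theorem continuous_duhamel_integrand (hr : Continuous r) {f : ℝ → E d → Z}
    (hf : Continuous (Function.uncurry f)) {C : ℝ} (hC : ∀ s x, ‖f s x‖ ≤ C) (t : ℝ) (x : E d) :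
    Continuous fun s => avg μ (r (t - s)) (f s) x :=
  (continuous_avg_family (μ := μ) hr hf hC).comp (f := fun s : ℝ => (t - s, s, x)) (by fun_prop)

theorem norm_duhamel_le {f : ℝ → E d → Z} {C : ℝ} (hC : ∀ s x, ‖f s x‖ ≤ C) {t : ℝ} (ht : 0 ≤ t)
    (x : E d) : ‖duhamel μ r f t x‖ ≤ C * t := by
  have h := intervalIntegral.norm_integral_le_of_norm_le_const (a := 0) (b := t) (C := C)
    (f := fun s => avg μ (r (t - s)) (f s) x) fun s _ => norm_avg_le (hC s) _ _
  rwa [sub_zero, abs_of_nonneg ht] at h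

theorem duhamel_sub (hr : Continuous r) {f g : ℝ → E d → Z}
    (hf : Continuous (Function.uncurry f)) (hg : Continuous (Function.uncurry g)) {C D : ℝ}
    (hC : ∀ s x, ‖f s x‖ ≤ C) (hD : ∀ s x, ‖g s x‖ ≤ D) (t : ℝ) (x : E d) :
    duhamel μ r (fun s y => f s y - g s y) t x = duhamel μ r f t x - duhamel μ r g t x := by
  rw [duhamel, duhamel, duhamel, ← intervalIntegral.integral_sub
    ((continuous_duhamel_integrand hr hf hC t x).intervalIntegrable _ _)
    ((continuous_duhamel_integrand hr hg hD t x).intervalIntegrable _ _)]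
  congr 1 with s
  exact avg_sub (by fun_prop) (by fun_prop) (hC s) (hD s) _ _

theorem norm_duhamel_sub_le (hr : Continuous r) {f g : ℝ → E d → Z}
    (hf : Continuous (Function.uncurry f)) (hg : Continuous (Function.uncurry g)) {C D : ℝ}
    (hC : ∀ s x, ‖f s x‖ ≤ C) (hD : ∀ s x, ‖g s x‖ ≤ D) {t : ℝ} (ht : 0 ≤ t) {b : ℝ → ℝ}
    (hb : Continuous b) (hfg : ∀ s ∈ Icc 0 t, ∀ y, ‖f s y - g s y‖ ≤ b s) (x : E d) :
    ‖duhamel μ r f t x - duhamel μ r g t x‖ ≤ ∫ s in (0 : ℝ)..t, b s := by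
  rw [← duhamel_sub hr hf hg hC hD]
  exact intervalIntegral.norm_integral_le_of_norm_le ht (Eventually.of_forall fun s hs =>
    norm_avg_le (hfg s (Ioc_subset_Icc_self hs)) _ _) (hb.intervalIntegrable _ _)

theorem tendsto_duhamel_cocompact (hr : Continuous r) {f : ℝ → E d → Z}
    (hf : Continuous (Function.uncurry f)) {C : ℝ} (hC : ∀ s x, ‖f s x‖ ≤ C)
    (h0 : ∀ s, Tendsto (f s) (cocompact (E d)) (𝓝 0)) (t : ℝ) :
    Tendsto (duhamel μ r f t) (cocompact (E d)) (𝓝 0) := by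
  have := isCountablyGenerated_cocompact (d := d)
  have h := intervalIntegral.tendsto_integral_filter_of_dominated_convergence
    (μ := volume) (a := 0) (b := t) (l := cocompact (E d))
    (F := fun x s => avg μ (r (t - s)) (f s) x) (f := fun _ => (0 : Z)) (fun _ => C)
    (Eventually.of_forall fun x =>
      (continuous_duhamel_integrand hr hf hC t x).aestronglyMeasurable)
    (Eventually.of_forall fun x => Eventually.of_forall fun s _ => norm_avg_le (hC s) _ _)
    (by simp)
    (Eventually.of_forall fun s _ => tendsto_avg_cocompact (by fun_prop) (hC s) (h0 s) _)
  rwa [intervalIntegral.integral_zero] at h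

/-- The Duhamel term of a source that is uniformly continuous in space, uniformly in time, is
uniformly continuous in space-time. -/
theorem exists_modulus_duhamel (hr : Continuous r) {f : ℝ → E d → Z}
    (hf : Continuous (Function.uncurry f)) {C : ℝ} (hC : ∀ s x, ‖f s x‖ ≤ C) {T : ℝ} (hT : 0 ≤ T)
    (hmod : ∀ ε > 0, ∃ δ > 0, ∀ s ∈ Icc 0 T, ∀ x x', dist x x' < δ → dist (f s x) (f s x') ≤ ε)
    {ε : ℝ} (hε : 0 < ε) :
    ∃ δ > 0, ∀ t ∈ Icc 0 T, ∀ t' ∈ Icc 0 T, ∀ x x', dist t t' < δ → dist x x' < δ →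
      dist (duhamel μ r f t x) (duhamel μ r f t' x') ≤ ε := by
  have hC0 : 0 ≤ C := (norm_nonneg _).trans (hC 0 0)
  have hη : 0 < ε / (4 * (T + 1)) := by positivity
  obtain ⟨δ₁, hδ₁, h₁⟩ := hmod _ hη
  obtain ⟨δ₂, hδ₂, h₂⟩ := exists_modulus_avg (Z := Z) μ (C := C) hη hδ₁
  obtain ⟨δ₃, hδ₃, h₃⟩ := Metric.uniformContinuousOn_iff.1
    (isCompact_Icc.uniformContinuousOn_of_continuous (hr.continuousOn (s := Icc 0 T))) δ₂ hδ₂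
  -- The intermediate term uses the data t', x' in the average but integrates only up to t.
  -- Replacing the averages costs 2 · ε/(4(T+1)) per unit of time, hence at most ε/2; the missing
  -- piece over [t, t'] costs C|t' - t| ≤ ε/2.
  have key : ∀ t ∈ Icc 0 T, ∀ t' ∈ Icc 0 T, t ≤ t' → ∀ x x',
      dist t t' < min δ₂ (min δ₃ (ε / (2 * (C + 1)))) →
      dist x x' < min δ₂ (min δ₃ (ε / (2 * (C + 1)))) →
      dist (duhamel μ r f t x) (duhamel μ r f t' x') ≤ ε := by
    intro t ht t' ht' htt x x' hd hx
    simp only [lt_min_iff] at hd hx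
    have hi : ∀ a b : ℝ, IntervalIntegrable (fun s => avg μ (r (t' - s)) (f s) x') volume a b :=
      fun a b => (continuous_duhamel_integrand hr hf hC t' x').intervalIntegrable _ _
    have h4 : dist (duhamel μ r f t x) (∫ s in (0 : ℝ)..t, avg μ (r (t' - s)) (f s) x')
        ≤ ε / 2 := by
      rw [duhamel, dist_eq_norm, ← intervalIntegral.integral_sub
        ((continuous_duhamel_integrand hr hf hC t x).intervalIntegrable _ _) (hi _ _)]
      refine (intervalIntegral.norm_integral_le_of_norm_le_const
        (C := 2 * (ε / (4 * (T + 1)))) fun s hs => ?_).trans ?_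
      · rw [uIoc_of_le ht.1] at hs
        rw [← dist_eq_norm]
        refine h₂ (f s) (by fun_prop) (hC s) (h₁ s ⟨hs.1.le, hs.2.trans ht.2⟩) _ _ _ _
          (h₃ _ ⟨sub_nonneg.2 hs.2, by linarith [hs.1, ht.2]⟩ _
            ⟨sub_nonneg.2 (hs.2.trans htt), by linarith [hs.1, ht'.2]⟩ ?_) hx.1
        rw [dist_sub_right]
        exact hd.2.1
      · rw [sub_zero, abs_of_nonneg ht.1]
        have h5 : 2 * (ε / (4 * (T + 1))) * t ≤ 2 * (ε / (4 * (T + 1))) * (T + 1) := by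
          gcongr
          linarith [ht.2]
        refine h5.trans (le_of_eq ?_)
        field_simp
        norm_num
    have h5 : dist (∫ s in (0 : ℝ)..t, avg μ (r (t' - s)) (f s) x') (duhamel μ r f t' x')
        ≤ ε / 2 := by
      rw [duhamel, dist_comm, dist_eq_norm,
        intervalIntegral.integral_interval_sub_left (hi _ _) (hi _ _)]
      refine (intervalIntegral.norm_integral_le_of_norm_le_const (C := C)
        fun s _ => norm_avg_le (hC s) _ _).trans ?_
      have h6 : |t' - t| < ε / (2 * (C + 1)) := by
        rw [abs_sub_comm]; exact hd.2.2
      rw [lt_div_iff₀ (by positivity)] at h6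
      nlinarith [abs_nonneg (t' - t)]
    linarith [dist_triangle (duhamel μ r f t x)
      (∫ s in (0 : ℝ)..t, avg μ (r (t' - s)) (f s) x') (duhamel μ r f t' x')]
  refine ⟨min δ₂ (min δ₃ (ε / (2 * (C + 1)))), by positivity, fun t ht t' ht' x x' hd hx => ?_⟩
  rcases le_total t t' with h | h
  · exact key t ht t' ht' h x x' hd hx
  · rw [dist_comm]
    exact key t' ht' t ht h x' x (by rwa [dist_comm]) (by rwa [dist_comm])

end Duhamel

/-! ### Closedness of the function spaces -/

section Spaces

variable {d : ℕ} {Z : Type*} [NormedAddCommGroup Z] [NormedSpace ℝ Z]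

theorem isClosed_Cu : IsClosed (Cu d Z : Set (E d →ᵇ Z)) := by
  refine IsSeqClosed.isClosed fun f g hf hg => ?_
  exact (BoundedContinuousFunction.tendsto_iff_tendstoUniformly.1 hg).uniformContinuous
    (Frequently.of_forall hf)

theorem isClosed_CZero : IsClosed (CZero d Z : Set (E d →ᵇ Z)) := by
  have h : (CZero d Z : Set (E d →ᵇ Z)) =
      range (ZeroAtInftyContinuousMap.toBCF : ZeroAtInftyContinuousMap (E d) Z → (E d →ᵇ Z)) := by
    ext f
    constructor
    · intro hf
      exact ⟨⟨f.toContinuousMap, hf⟩, rfl⟩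
    · rintro ⟨g, rfl⟩
      exact g.zero_at_infty'
  rw [h]
  exact ZeroAtInftyContinuousMap.isClosed_range_toBCF

theorem CZero_le_Cu : CZero d Z ≤ Cu d Z := fun f hf =>
  Continuous.uniformContinuous_of_tendsto_cocompact f.continuous hf

instance [CompleteSpace Z] : CompleteSpace (Cu d Z) :=
  (isClosed_Cu (d := d) (Z := Z)).completeSpace_coe

end Spaces

/-! ### A fixed-point principle and the clipping of time -/

/-- If the iterates of a self-map of a complete space have Lipschitz constants tending to `0`, they
converge to a fixed point. -/
theorem exists_fixedPoint_of_iterate {X : Type*} [MetricSpace X] [CompleteSpace X] [Nonempty X]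
    (Φ : X → X) {a : ℕ → ℝ} (ha : Tendsto a atTop (𝓝 0))
    (hΦ : ∀ n x y, dist (Φ^[n] x) (Φ^[n] y) ≤ a n * dist x y) :
    ∃ p, Φ p = p ∧ ∀ x, Tendsto (fun n => Φ^[n] x) atTop (𝓝 p) := by
  obtain ⟨N, hN⟩ := (ha.eventually (gt_mem_nhds (show (0 : ℝ) < 1 / 2 by norm_num))).exists
  have hc : ContractingWith (1 / 2) Φ^[N] := by
    refine ⟨by norm_num, LipschitzWith.of_dist_le_mul fun x y => (hΦ N x y).trans ?_⟩
    refine mul_le_mul_of_nonneg_right ?_ dist_nonneg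
    simpa using hN.le
  obtain ⟨p, hp⟩ : ∃ p, Function.IsFixedPt Φ p := ⟨_, hc.isFixedPt_fixedPoint_iterate⟩
  refine ⟨p, hp, fun x => tendsto_iff_dist_tendsto_zero.2 ?_⟩
  refine squeeze_zero (fun _ => dist_nonneg) (fun n => ?_)
    (by simpa using ha.mul_const (dist x p))
  have h := hΦ n x p
  rwa [hp.iterate n] at h

/-- The retraction of `ℝ` onto `[0, T]`. -/
def clip (T t : ℝ) : ℝ := max 0 (min T t)

theorem clip_mem {T : ℝ} (hT : 0 ≤ T) (t : ℝ) : clip T t ∈ Icc 0 T :=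
  ⟨le_max_left _ _, max_le hT (min_le_left _ _)⟩

theorem clip_of_mem {T t : ℝ} (ht : t ∈ Icc 0 T) : clip T t = t := by
  rw [clip, min_eq_right ht.2, max_eq_right ht.1]

theorem continuous_clip (T : ℝ) : Continuous (clip T) := by
  unfold clip
  fun_prop

/-! ### Picard iteration for tame nonlinearities, and its invariant subspaces -/

section Volterra

variable {d : ℕ} {Z : Type*} [NormedAddCommGroup Z] [NormedSpace ℝ Z]

/-- A bounded space-time function that is uniformly continuous on `[0, T] × ℝᵈ` is a bounded
continuous path in `C_u`. -/
theorem exists_path {T : ℝ} (hT : 0 ≤ T) {h : ℝ → E d → Z} {C : ℝ}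
    (hC : ∀ t ∈ Icc 0 T, ∀ x, ‖h t x‖ ≤ C)
    (hmod : ∀ ε > 0, ∃ δ > 0, ∀ t ∈ Icc 0 T, ∀ t' ∈ Icc 0 T, ∀ x x', dist t t' < δ →
      dist x x' < δ → dist (h t x) (h t' x') ≤ ε) :
    ∃ U : ℝ →ᵇ Cu d Z, ∀ t x, (U t : E d →ᵇ Z) x = h (clip T t) x := by
  have hC0 : 0 ≤ C := (norm_nonneg _).trans (hC 0 ⟨le_rfl, hT⟩ 0)
  have huc : ∀ t, UniformContinuous (h (clip T t)) := fun t =>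
    Metric.uniformContinuous_iff.2 fun ε hε => by
      obtain ⟨δ, hδ, h1⟩ := hmod (ε / 2) (half_pos hε)
      exact ⟨δ, hδ, fun x x' hx => (h1 _ (clip_mem hT t) _ (clip_mem hT t) x x'
        (by simpa using hδ) hx).trans_lt (half_lt_self hε)⟩
  let U : ℝ → Cu d Z := fun t => ⟨BoundedContinuousFunction.ofNormedAddCommGroup (h (clip T t))
    (huc t).continuous C (hC _ (clip_mem hT t)), huc t⟩
  have hU : Continuous U := Metric.continuous_iff.2 fun t ε hε => by
    obtain ⟨δ, hδ, h1⟩ := hmod (ε / 2) (half_pos hε)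
    obtain ⟨δ', hδ', h2⟩ := Metric.continuous_iff.1 (continuous_clip T) t δ hδ
    refine ⟨δ', hδ', fun t' ht' => lt_of_le_of_lt ?_ (half_lt_self hε)⟩
    exact (BoundedContinuousFunction.dist_le (half_pos hε).le).2 fun x =>
      h1 _ (clip_mem hT t') _ (clip_mem hT t) x x (h2 t' ht') (by simpa using hδ)
  exact ⟨BoundedContinuousFunction.ofNormedAddCommGroup U hU C fun t =>
    BoundedContinuousFunction.norm_ofNormedAddCommGroup_le (huc t).continuous hC0
      (hC _ (clip_mem hT t)), fun t x => rfl⟩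

/-- Bounded continuous nonlinearities that are globally Lipschitz in the second variable. -/
structure IsTame (G : ℝ → Z → Z) (C L : ℝ) : Prop where
  continuous : Continuous (Function.uncurry G)
  bound : ∀ s z, ‖G s z‖ ≤ C
  lipschitz : ∀ s z z', ‖G s z - G s z'‖ ≤ L * ‖z - z'‖
  nonneg : 0 ≤ L

/-- The superposition `(s, y) ↦ G(s, u(s, y))`. -/
def source (G : ℝ → Z → Z) (u : ℝ →ᵇ Cu d Z) (s : ℝ) (y : E d) : Z :=
  G s ((u s : E d →ᵇ Z) y)

variable {G : ℝ → Z → Z} {C L : ℝ}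

theorem IsTame.continuous_source (hG : IsTame G C L) (u : ℝ →ᵇ Cu d Z) :
    Continuous (Function.uncurry (source G u)) := by
  refine hG.continuous.comp (f := fun p : ℝ × E d => (p.1, (u p.1 : E d →ᵇ Z) p.2))
    (continuous_fst.prodMk ?_)
  exact Continuous.eval (((continuous_subtype_val.comp u.continuous).comp continuous_fst)) continuous_snd

/-- Compactness of the time interval: near a time `s` the path is within ε/3 of `u s` in sup norm,
so the modulus of `u s` serves for all nearby times. -/
theorem exists_modulus_path (u : ℝ →ᵇ Cu d Z) (T : ℝ) {ε : ℝ} (hε : 0 < ε) :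
    ∃ δ > 0, ∀ s ∈ Icc 0 T, ∀ x x', dist x x' < δ →
      dist ((u s : E d →ᵇ Z) x) ((u s : E d →ᵇ Z) x') ≤ ε := by
  refine (isCompact_Icc (a := (0 : ℝ)) (b := T)).induction_on (p := fun K => ∃ δ > 0, ∀ s ∈ K,
    ∀ x x', dist x x' < δ → dist ((u s : E d →ᵇ Z) x) ((u s : E d →ᵇ Z) x') ≤ ε)
    ⟨1, one_pos, by simp⟩ ?_ ?_ ?_
  · rintro K K' hKK ⟨δ, hδ, h⟩
    exact ⟨δ, hδ, fun s hs => h s (hKK hs)⟩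
  · rintro K K' ⟨δ, hδ, h⟩ ⟨δ', hδ', h'⟩
    refine ⟨min δ δ', lt_min hδ hδ', fun s hs x x' hx => ?_⟩
    rw [lt_min_iff] at hx
    exact hs.elim (fun hs => h s hs x x' hx.1) fun hs => h' s hs x x' hx.2
  · intro s _
    have hε3 : 0 < ε / 3 := by positivity
    obtain ⟨δ, hδ, h⟩ := Metric.uniformContinuous_iff.1 (u s).2 (ε / 3) hε3
    refine ⟨u ⁻¹' Metric.ball (u s) (ε / 3), mem_nhdsWithin_of_mem_nhds
      (u.continuous.continuousAt.preimage_mem_nhds (Metric.ball_mem_nhds _ hε3)), δ, hδ,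
      fun s' hs' x x' hx => ?_⟩
    have h1 : ∀ y, dist ((u s' : E d →ᵇ Z) y) ((u s : E d →ᵇ Z) y) ≤ ε / 3 := fun y =>
      (BoundedContinuousFunction.dist_coe_le_dist y).trans (le_of_lt hs')
    have h2 := h hx
    have h3 := dist_triangle4 ((u s' : E d →ᵇ Z) x) ((u s : E d →ᵇ Z) x) ((u s : E d →ᵇ Z) x')
      ((u s' : E d →ᵇ Z) x')
    have h4 := h1 x'
    rw [dist_comm] at h4
    linarith [h1 x]

variable (μ : Measure (E d)) (r : ℝ → ℝ) (T : ℝ)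

/-- The path `u` solves the integral equation with nonlinearity `G` on `[0, T]` and is constant
outside `[0, T]`. -/
def IsVolterra (G : ℝ → Z → Z) (u₀ : E d →ᵇ Z) (u : ℝ →ᵇ Cu d Z) : Prop :=
  ∀ t x, (u t : E d →ᵇ Z) x =
    avg μ (r (clip T t)) u₀ x + duhamel μ r (source G u) (clip T t) x

variable {μ r T}

theorem IsVolterra.isFixedPt {u₀ : E d →ᵇ Z} {u : ℝ →ᵇ Cu d Z} (hu : IsVolterra μ r T G u₀ u)
    {Φ : (ℝ →ᵇ Cu d Z) → (ℝ →ᵇ Cu d Z)} (hΦ : ∀ u t x, (Φ u t : E d →ᵇ Z) x =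
      avg μ (r (clip T t)) u₀ x + duhamel μ r (source G u) (clip T t) x) :
    Function.IsFixedPt Φ u := by
  ext t x
  rw [hΦ, hu t x]

/-- The Picard orbit of a solution is constant, while every orbit tends to `p`. A solution is thus
the limit of the iterates from 0, on which invariant properties can be checked by induction. -/
theorem IsVolterra.eq_of_tendsto {u₀ : E d →ᵇ Z} {u p : ℝ →ᵇ Cu d Z}
    (hu : IsVolterra μ r T G u₀ u)
    {Φ : (ℝ →ᵇ Cu d Z) → (ℝ →ᵇ Cu d Z)} (hΦ : ∀ u t x, (Φ u t : E d →ᵇ Z) x =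
      avg μ (r (clip T t)) u₀ x + duhamel μ r (source G u) (clip T t) x)
    (hp : ∀ u, Tendsto (fun n => Φ^[n] u) atTop (𝓝 p)) : u = p :=
  tendsto_nhds_unique tendsto_const_nhds
    ((hp u).congr fun n => (hu.isFixedPt hΦ).iterate n)

variable [IsProbabilityMeasure μ]

theorem IsTame.exists_picard_step (hG : IsTame G C L) (hr : Continuous r) (hT : 0 ≤ T)
    {u₀ : E d →ᵇ Z} (hu₀ : u₀ ∈ Cu d Z) (u : ℝ →ᵇ Cu d Z) :
    ∃ u' : ℝ →ᵇ Cu d Z, ∀ t x, (u' t : E d →ᵇ Z) x =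
      avg μ (r (clip T t)) u₀ x + duhamel μ r (source G u) (clip T t) x := by
  have hC0 : 0 ≤ C := (norm_nonneg _).trans (hG.bound 0 0)
  refine exists_path hT (C := ‖u₀‖ + C * T)
    (h := fun t x => avg μ (r t) u₀ x + duhamel μ r (source G u) t x) (fun t ht x => ?_)
    fun ε hε => ?_
  · refine (norm_add_le _ _).trans (add_le_add (norm_avg_le u₀.norm_coe_le_norm _ _) ?_)
    exact (norm_duhamel_le (fun s x => hG.bound _ _) ht.1 x).trans
      (mul_le_mul_of_nonneg_left ht.2 hC0)
  -- `exists_modulus_avg` doubles its tolerance, so ε/4 yields ε/2 for the free term; the Duhamel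
  -- term takes the other half.
  · have hε4 : 0 < ε / 4 := by positivity
    obtain ⟨δ₁, hδ₁, h₁⟩ := Metric.uniformContinuous_iff.1 hu₀ (ε / 4) hε4
    obtain ⟨δ₂, hδ₂, h₂⟩ := exists_modulus_avg (Z := Z) μ (C := ‖u₀‖) hε4 hδ₁
    obtain ⟨δ₃, hδ₃, h₃⟩ := Metric.uniformContinuousOn_iff.1
      (isCompact_Icc.uniformContinuousOn_of_continuous (hr.continuousOn (s := Icc 0 T))) δ₂ hδ₂
    obtain ⟨δ₄, hδ₄, h₄⟩ := exists_modulus_duhamel (μ := μ) hr (hG.continuous_source u)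
      (C := C) (fun s x => hG.bound _ _) hT (fun η hη => by
        have hL := hG.nonneg
        obtain ⟨δ, hδ, h⟩ := exists_modulus_path u T (ε := η / (L + 1)) (by positivity)
        refine ⟨δ, hδ, fun s hs x x' hx => ?_⟩
        rw [dist_eq_norm]
        refine (hG.lipschitz _ _ _).trans ?_
        have h5 := h s hs x x' hx
        rw [dist_eq_norm, le_div_iff₀ (by positivity)] at h5
        nlinarith [norm_nonneg ((u s : E d →ᵇ Z) x - (u s : E d →ᵇ Z) x')]) (half_pos hε)
    refine ⟨min δ₂ (min δ₃ δ₄), by positivity, fun t ht t' ht' x x' hd hx => ?_⟩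
    simp only [lt_min_iff] at hd hx
    refine (dist_add_add_le _ _ _ _).trans ?_
    have h6 := h₂ u₀ u₀.continuous u₀.norm_coe_le_norm (fun y y' hy => (h₁ hy).le) (r t) (r t') x x'
      (h₃ t ht t' ht' hd.2.1) hx.1
    have h7 := h₄ t ht t' ht' x x' hd.2.2 hx.2.2
    linarith

/-- Each iteration integrates the previous difference once more in time, which gives the factor
(Lt)^n / n!. It tends to 0 for every `T`, so no smallness of the interval is needed. -/
theorem IsTame.exists_picard (hG : IsTame G C L) (hr : Continuous r) (hT : 0 ≤ T)
    [CompleteSpace Z] {u₀ : E d →ᵇ Z} (hu₀ : u₀ ∈ Cu d Z) :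
    ∃ Φ : (ℝ →ᵇ Cu d Z) → (ℝ →ᵇ Cu d Z), (∀ u t x, (Φ u t : E d →ᵇ Z) x =
      avg μ (r (clip T t)) u₀ x + duhamel μ r (source G u) (clip T t) x) ∧
      ∃ p, Φ p = p ∧ ∀ u, Tendsto (fun n => Φ^[n] u) atTop (𝓝 p) := by
  choose Φ hΦ using hG.exists_picard_step (μ := μ) hr hT hu₀
  refine ⟨Φ, hΦ, ?_⟩
  have hL := hG.nonneg
  have key : ∀ (u v : ℝ →ᵇ Cu d Z) (n : ℕ), ∀ t ∈ Icc 0 T, ∀ x,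
      ‖(Φ^[n] u t : E d →ᵇ Z) x - (Φ^[n] v t : E d →ᵇ Z) x‖ ≤
        (L * t) ^ n / n.factorial * dist u v := by
    intro u v n
    induction n with
    | zero =>
      intro t _ x
      simp only [Function.iterate_zero, id, pow_zero, Nat.factorial_zero, Nat.cast_one, div_one,
        one_mul]
      rw [← dist_eq_norm]
      exact (BoundedContinuousFunction.dist_coe_le_dist (f := (u t : E d →ᵇ Z))
        (g := (v t : E d →ᵇ Z)) x).trans (BoundedContinuousFunction.dist_coe_le_dist (f := u) (g := v) t)
    | succ n ih =>
      intro t ht x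
      rw [Function.iterate_succ_apply', Function.iterate_succ_apply', hΦ, hΦ, clip_of_mem ht,
        add_sub_add_left_eq_sub]
      refine (norm_duhamel_sub_le hr (hG.continuous_source _) (hG.continuous_source _)
        (C := C) (D := C) (fun s x => hG.bound _ _) (fun s x => hG.bound _ _) ht.1
        (b := fun s => L * ((L * s) ^ n / n.factorial * dist u v)) (by fun_prop)
        (fun s hs y => (hG.lipschitz _ _ _).trans ?_) x).trans (le_of_eq ?_)
      · exact mul_le_mul_of_nonneg_left (ih s ⟨hs.1, hs.2.trans ht.2⟩ y) hL
      · have h1 : ∀ s : ℝ, L * ((L * s) ^ n / n.factorial * dist u v) =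
            (L ^ (n + 1) / n.factorial * dist u v) * s ^ n := fun s => by
          rw [mul_pow]; ring
        simp_rw [h1]
        rw [intervalIntegral.integral_const_mul, integral_pow, Nat.factorial_succ]
        push_cast
        field_simp
        simp
        ring
  refine exists_fixedPoint_of_iterate Φ
    (FloorSemiring.tendsto_pow_div_factorial_atTop (L * T)) fun n u v => ?_
  -- The paths themselves are arbitrary outside [0, T], but after one application of Φ they are
  -- constant there. For positive `n` it therefore suffices to compare at clipped times.
  cases n with
  | zero => simp
  | succ n =>
    have h0 : 0 ≤ (L * T) ^ (n + 1) / (n + 1).factorial * dist u v := by positivity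
    refine (BoundedContinuousFunction.dist_le h0).2 fun t =>
      (BoundedContinuousFunction.dist_le h0).2 fun x => ?_
    have h1 : ∀ w : ℝ →ᵇ Cu d Z, ∀ y, (Φ^[n + 1] w t : E d →ᵇ Z) y =
        (Φ^[n + 1] w (clip T t) : E d →ᵇ Z) y := fun w y => by
      rw [Function.iterate_succ_apply', hΦ, hΦ, clip_of_mem (clip_mem hT t)]
    rw [h1, h1, dist_eq_norm]
    refine (key u v (n + 1) _ (clip_mem hT t) x).trans ?_
    have h2 := (clip_mem hT t).2
    have h3 := (clip_mem hT t).1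
    gcongr

theorem IsTame.exists_isVolterra (hG : IsTame G C L) (hr : Continuous r) (hT : 0 ≤ T)
    [CompleteSpace Z] {u₀ : E d →ᵇ Z} (hu₀ : u₀ ∈ Cu d Z) :
    ∃ u : ℝ →ᵇ Cu d Z, IsVolterra μ r T G u₀ u := by
  obtain ⟨Φ, hΦ, p, hp, -⟩ := hG.exists_picard (μ := μ) hr hT hu₀
  exact ⟨p, fun t x => by rw [← hΦ, hp]⟩

theorem IsVolterra.unique (hG : IsTame G C L) (hr : Continuous r) (hT : 0 ≤ T)
    [CompleteSpace Z] {u₀ : E d →ᵇ Z} (hu₀ : u₀ ∈ Cu d Z) {u v : ℝ →ᵇ Cu d Z}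
    (hu : IsVolterra μ r T G u₀ u) (hv : IsVolterra μ r T G u₀ v) : u = v := by
  obtain ⟨Φ, hΦ, p, -, hp⟩ := hG.exists_picard (μ := μ) hr hT hu₀
  rw [hu.eq_of_tendsto hΦ hp, hv.eq_of_tendsto hΦ hp]

/-- Averaging commutes with translations and the nonlinearity does not depend on `x`, so all
iterates from 0 are periodic; pointwise limits keep the periods. -/
theorem IsVolterra.mem_CuPer (hG : IsTame G C L) (hr : Continuous r) (hT : 0 ≤ T)
    [CompleteSpace Z] {Γ : Submodule ℤ (E d)} {u₀ : E d →ᵇ Z} (hu₀ : u₀ ∈ CuPer Z Γ)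
    {u : ℝ →ᵇ Cu d Z} (hu : IsVolterra μ r T G u₀ u) (t : ℝ) : (u t : E d →ᵇ Z) ∈ CuPer Z Γ := by
  obtain ⟨Φ, hΦ, p, -, hp⟩ := hG.exists_picard (μ := μ) hr hT hu₀.1
  rw [hu.eq_of_tendsto hΦ hp]
  have hper : ∀ n t, ∀ a ∈ Γ, ∀ x, (Φ^[n] 0 t : E d →ᵇ Z) (x + a) = (Φ^[n] 0 t : E d →ᵇ Z) x := by
    intro n
    induction n with
    | zero => exact fun t a _ x => rfl
    | succ n ih =>
      intro t a ha x
      rw [Function.iterate_succ_apply', hΦ, hΦ, avg_add_period (hu₀.2 a ha),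
        duhamel_add_period fun s y => by rw [source, source, ih s a ha]]
  refine ⟨(p t).2, fun a ha x => ?_⟩
  have hlim : ∀ y, Tendsto (fun n => (Φ^[n] 0 t : E d →ᵇ Z) y) atTop (𝓝 ((p t : E d →ᵇ Z) y)) :=
    fun y => ((continuous_eval_const (F := E d →ᵇ Z) y).comp
      (continuous_subtype_val.comp
        (continuous_eval_const t))).continuousAt.tendsto.comp (hp 0)
  refine tendsto_nhds_unique (hlim (x + a)) ?_
  simp_rw [hper _ t a ha]
  exact hlim x

/-- The two Picard sequences from 0 are compared term by term. The Lipschitz bound makes the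
difference of the sources decay wherever the difference of the iterates does, and C_0 is closed in
the sup norm. -/
theorem IsVolterra.sub_mem_CZero (hG : IsTame G C L) (hr : Continuous r) (hT : 0 ≤ T)
    [CompleteSpace Z] {u₀ v₀ : E d →ᵇ Z} (hu₀ : u₀ ∈ Cu d Z) (hv₀ : v₀ ∈ Cu d Z)
    (h₀ : u₀ - v₀ ∈ CZero d Z) {u v : ℝ →ᵇ Cu d Z} (hu : IsVolterra μ r T G u₀ u)
    (hv : IsVolterra μ r T G v₀ v) (t : ℝ) :
    (u t : E d →ᵇ Z) - (v t : E d →ᵇ Z) ∈ CZero d Z := by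
  obtain ⟨Φ, hΦ, p, -, hp⟩ := hG.exists_picard (μ := μ) hr hT hu₀
  obtain ⟨Ψ, hΨ, q, -, hq⟩ := hG.exists_picard (μ := μ) hr hT hv₀
  rw [hu.eq_of_tendsto hΦ hp, hv.eq_of_tendsto hΨ hq]
  have hmem : ∀ n t, (Φ^[n] 0 t : E d →ᵇ Z) - (Ψ^[n] 0 t : E d →ᵇ Z) ∈ CZero d Z := by
    intro n
    induction n with
    | zero => intro t; simp
    | succ n ih =>
      intro t
      have h1 : ∀ x, ((Φ^[n + 1] 0 t : E d →ᵇ Z) - (Ψ^[n + 1] 0 t : E d →ᵇ Z)) x =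
          avg μ (r (clip T t)) (fun y => u₀ y - v₀ y) x + duhamel μ r
            (fun s y => source G (Φ^[n] 0) s y - source G (Ψ^[n] 0) s y) (clip T t) x := by
        intro x
        rw [BoundedContinuousFunction.sub_apply, Function.iterate_succ_apply',
          Function.iterate_succ_apply', hΦ, hΨ,
          avg_sub u₀.continuous v₀.continuous u₀.norm_coe_le_norm v₀.norm_coe_le_norm,
          duhamel_sub hr (hG.continuous_source _) (hG.continuous_source _)
            (C := C) (D := C) (fun s x => hG.bound _ _) (fun s x => hG.bound _ _)]
        abel
      have hb0 : ∀ y, ‖u₀ y - v₀ y‖ ≤ ‖u₀ - v₀‖ := (u₀ - v₀).norm_coe_le_norm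
      have h2 := tendsto_avg_cocompact (μ := μ) (f := fun y => u₀ y - v₀ y)
        (u₀.continuous.sub v₀.continuous) hb0 h₀ (r (clip T t))
      have h3 := tendsto_duhamel_cocompact (μ := μ) hr
        (f := fun s y => source G (Φ^[n] 0) s y - source G (Ψ^[n] 0) s y) (C := C + C)
        ((hG.continuous_source _).sub (hG.continuous_source _))
        (fun s x => (norm_sub_le _ _).trans (add_le_add (hG.bound _ _) (hG.bound _ _)))
        (fun s => squeeze_zero_norm (fun y => hG.lipschitz s _ _)
          (by simpa using (Tendsto.norm (ih s)).const_mul L)) (clip T t)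
      have h4 := h2.add h3
      rw [add_zero] at h4
      exact h4.congr fun x => (h1 x).symm
  have hlim : ∀ {w : ℕ → ℝ →ᵇ Cu d Z} {q}, Tendsto w atTop (𝓝 q) →
      Tendsto (fun n => (w n t : E d →ᵇ Z)) atTop (𝓝 (q t : E d →ᵇ Z)) := fun hw =>
    (continuous_subtype_val.comp
      (continuous_eval_const t)).continuousAt.tendsto.comp hw
  exact isClosed_CZero.mem_of_tendsto ((hlim (hp 0)).sub (hlim (hq 0)))
    (Eventually.of_forall fun n => hmem n t)

end Volterra

/-! ### Cutting off the nonlinearity -/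

section Truncation

variable {Z : Type*} [NormedAddCommGroup Z] [NormedSpace ℝ Z]

/-- The radial retraction of `Z` onto the ball of radius `R`. -/
def radial (R : ℝ) (z : Z) : Z := (R / max R ‖z‖) • z

theorem radial_of_norm_le {R : ℝ} (hR : 0 < R) {z : Z} (hz : ‖z‖ ≤ R) : radial R z = z := by
  rw [radial, max_eq_left hz, div_self hR.ne', one_smul]

theorem norm_radial_le {R : ℝ} (hR : 0 < R) (z : Z) : ‖radial R z‖ ≤ R := by
  have hm : 0 < max R ‖z‖ := lt_max_of_lt_left hR
  rw [radial, norm_smul, Real.norm_of_nonneg (by positivity), div_mul_eq_mul_div,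
    div_le_iff₀ hm]
  exact mul_le_mul_of_nonneg_left (le_max_right _ _) hR.le

/-- In a general normed space the constant 2 arises from two changes, that of the vector and that of
the scaling factor, each costing at most ‖z - z'‖. -/
theorem norm_radial_sub_le {R : ℝ} (hR : 0 < R) (z z' : Z) :
    ‖radial R z - radial R z'‖ ≤ 2 * ‖z - z'‖ := by
  have hm : 0 < max R ‖z‖ := lt_max_of_lt_left hR
  have hm' : 0 < max R ‖z'‖ := lt_max_of_lt_left hR
  have h1 : radial R z - radial R z' = (R / max R ‖z‖) • (z - z')
      + (R / max R ‖z‖ - R / max R ‖z'‖) • z' := by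
    simp only [radial, smul_sub, sub_smul]
    abel
  have h2 : ‖(R / max R ‖z‖) • (z - z')‖ ≤ ‖z - z'‖ := by
    rw [norm_smul, Real.norm_of_nonneg (by positivity)]
    exact mul_le_of_le_one_left (norm_nonneg _) ((div_le_one hm).2 (le_max_left _ _))
  have h3 : ‖(R / max R ‖z‖ - R / max R ‖z'‖) • z'‖ ≤ ‖z - z'‖ := by
    have h4 : R / max R ‖z‖ - R / max R ‖z'‖ =
        (R / max R ‖z‖) * ((max R ‖z'‖ - max R ‖z‖) / max R ‖z'‖) := by
      field_simp
    have h5 : |max R ‖z'‖ - max R ‖z‖| ≤ ‖z - z'‖ := by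
      rw [abs_sub_comm]
      have h := abs_max_sub_max_le_max R ‖z‖ R ‖z'‖
      rw [sub_self, abs_zero, max_eq_right (abs_nonneg (‖z‖ - ‖z'‖))] at h
      exact h.trans (abs_norm_sub_norm_le z z')
    rw [norm_smul, h4, norm_mul, Real.norm_of_nonneg (show 0 ≤ R / max R ‖z‖ by positivity),
      norm_div, Real.norm_of_nonneg hm'.le, Real.norm_eq_abs, mul_assoc]
    refine (mul_le_of_le_one_left (by positivity) ((div_le_one hm).2 (le_max_left _ _))).trans ?_
    rw [div_mul_eq_mul_div, div_le_iff₀ hm']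
    exact mul_le_mul h5 (le_max_right _ _) (norm_nonneg _) (norm_nonneg _)
  rw [h1]
  linarith [norm_add_le ((R / max R ‖z‖) • (z - z')) ((R / max R ‖z‖ - R / max R ‖z'‖) • z')]

theorem continuous_radial {R : ℝ} (hR : 0 < R) : Continuous (radial R : Z → Z) := by
  unfold radial
  refine Continuous.smul (Continuous.div (by fun_prop) (by fun_prop) fun z => ?_) continuous_id
  exact (lt_max_of_lt_left hR).ne'

/-- The nonlinearity cut off in time at `T` and in the second variable at radius `R`. -/
def cutoff (F : ℝ → Z → Z) (T R : ℝ) (t : ℝ) (z : Z) : Z := F (clip T t) (radial R z)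

theorem cutoff_eq (F : ℝ → Z → Z) {T R t : ℝ} (ht : t ∈ Icc 0 T) (hR : 0 < R) {z : Z}
    (hz : ‖z‖ ≤ R) : cutoff F T R t z = F t z := by
  rw [cutoff, clip_of_mem ht, radial_of_norm_le hR hz]

theorem exists_isTame_cutoff {F : ℝ → Z → Z}
    (hF : ContinuousOn (Function.uncurry F) (Ici 0 ×ˢ univ)) (hFL : LocallyLipschitzSnd F)
    {T R : ℝ} (hT : 0 ≤ T) (hR : 0 < R) : ∃ C L, IsTame (cutoff F T R) C L := by
  -- `LocallyLipschitzSnd` asks for a positive time, while `T` may be 0.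
  obtain ⟨L, hL, h⟩ := hFL R hR (T + 1) (by linarith)
  obtain ⟨A, hA⟩ := (isCompact_Icc (a := 0) (b := T)).exists_bound_of_continuousOn
    (f := fun s => F s 0) (hF.comp (f := fun s : ℝ => (s, (0 : Z))) (by fun_prop)
      fun s hs => ⟨hs.1, mem_univ _⟩)
  have hmem : ∀ s, clip T s ∈ Icc 0 (T + 1) := fun s =>
    ⟨(clip_mem hT s).1, (clip_mem hT s).2.trans (by linarith)⟩
  refine ⟨L * R + A, L * 2, ?_, fun s z => ?_, fun s z z' => ?_, by positivity⟩
  · refine hF.comp_continuous (f := fun p : ℝ × Z => (clip T p.1, radial R p.2)) ?_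
      fun p => ⟨(clip_mem hT p.1).1, mem_univ _⟩
    exact ((continuous_clip T).comp continuous_fst).prodMk
      ((continuous_radial hR).comp continuous_snd)
  · have h1 := h _ (hmem s) (radial R z) 0 (norm_radial_le hR z) (by simpa using hR.le)
    rw [sub_zero] at h1
    have h2 := norm_le_norm_sub_add (F (clip T s) (radial R z)) (F (clip T s) 0)
    have h3 := mul_le_mul_of_nonneg_left (norm_radial_le hR z) hL.le
    exact h2.trans (add_le_add (h1.trans h3) (hA _ (clip_mem hT s)))
  · refine (h _ (hmem s) _ _ (norm_radial_le hR z) (norm_radial_le hR z')).trans ?_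
    rw [mul_assoc]
    exact mul_le_mul_of_nonneg_left (norm_radial_sub_le hR z z') hL.le

end Truncation

/-! ### The propagator as an average -/

section Propagator

variable {d : ℕ} {Z : Type*} [NormedAddCommGroup Z] [NormedSpace ℝ Z]

/-- The probability measure with density `g_β`. -/
def stableMeasure (d : ℕ) (β : ℝ) : Measure (E d) :=
  volume.withDensity fun x => ENNReal.ofReal (gKernel β x)

theorem isProbabilityMeasure_stableMeasure [NeZero d] {β : ℝ} (hβ : 0 < β) (hβ' : β ≤ 1) :
    IsProbabilityMeasure (stableMeasure d β) := by
  refine ⟨?_⟩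
  rw [stableMeasure, withDensity_apply _ MeasurableSet.univ, Measure.restrict_univ, ← ofReal_integral_eq_lintegral_ofReal (integrable_gKernel hβ hβ')
    (Eventually.of_forall (gKernel_nonneg hβ hβ')), integral_gKernel hβ hβ', ENNReal.ofReal_one]

/-- The spatial scale `(σt)^{1/(2β)}` of the propagator at time `t`. -/
def scale (σ β t : ℝ) : ℝ := (σ * max t 0) ^ (1 / (2 * β))

theorem continuous_scale (σ : ℝ) {β : ℝ} (hβ : 0 < β) : Continuous (scale σ β) := by
  unfold scale
  exact Continuous.rpow_const (by fun_prop) fun _ => Or.inr (by positivity)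

/-- The change of variables y ↦ (σt)^{1/(2β)} y absorbs the prefactor of `GKernel`, and the
convention at σt = 0 becomes scale 0. Neither step requires measurability or integrability of `f`.
-/
theorem S_eq_avg [NeZero d] [CompleteSpace Z] {σ β : ℝ} (hσ : 0 ≤ σ) (hβ : 0 < β) (hβ' : β ≤ 1)
    {t : ℝ} (ht : 0 ≤ t) (f : E d → Z) :
    S σ β t f = avg (stableMeasure d β) (scale σ β t) f := by
  have := isProbabilityMeasure_stableMeasure (d := d) hβ hβ'
  rw [scale, max_eq_left ht, S]
  split_ifs with h
  · rw [h, Real.zero_rpow (by positivity), avg_zero]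
  · have hpos : 0 < σ * t := lt_of_le_of_ne (mul_nonneg hσ ht) (Ne.symm h)
    set τ := σ * t
    have hρ : 0 < τ ^ (1 / (2 * β)) := Real.rpow_pos_of_pos hpos _
    ext x
    rw [avg, stableMeasure, integral_withDensity_eq_integral_toReal_smul
      (continuous_gKernel hβ).measurable.ennreal_ofReal (by simp)]
    have h1 := Measure.integral_comp_smul (volume : Measure (E d))
      (fun y => GKernel σ β t y • f (x - y)) (τ ^ (1 / (2 * β)))
    have hne : |((τ ^ (1 / (2 * β))) ^ Module.finrank ℝ (E d))⁻¹| ≠ 0 := by positivity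
    rw [eq_comm, ← eq_inv_smul_iff₀ hne] at h1
    rw [h1, ← integral_smul]
    congr 1 with y
    rw [smul_smul, GKernel, ENNReal.toReal_ofReal (gKernel_nonneg hβ hβ' y), smul_smul,
      ← Real.rpow_add hpos, show -1 / (2 * β) + 1 / (2 * β) = 0 by ring, Real.rpow_zero, one_smul,
      ← mul_assoc, abs_of_pos (by positivity), inv_inv, finrank_euclideanSpace_fin,
      ← Real.rpow_natCast, ← Real.rpow_mul hpos.le, ← Real.rpow_add hpos,
      show 1 / (2 * β) * (d : ℝ) + -(d : ℝ) / (2 * β) = 0 by ring, Real.rpow_zero, one_mul]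

theorem S_add [NeZero d] [CompleteSpace Z] {σ β : ℝ} (hσ : 0 ≤ σ) (hβ : 0 < β) (hβ' : β ≤ 1)
    {t : ℝ} (ht : 0 ≤ t) {f g : E d → Z} (hf : Continuous f) (hg : Continuous g) {C D : ℝ}
    (hC : ∀ x, ‖f x‖ ≤ C) (hD : ∀ x, ‖g x‖ ≤ D) (x : E d) :
    S σ β t (fun y => f y + g y) x = S σ β t f x + S σ β t g x := by
  have := isProbabilityMeasure_stableMeasure (d := d) hβ hβ'
  simp_rw [S_eq_avg hσ hβ hβ' ht]
  exact avg_add hf hg hC hD _ _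

theorem S_sub [NeZero d] [CompleteSpace Z] {σ β : ℝ} (hσ : 0 ≤ σ) (hβ : 0 < β) (hβ' : β ≤ 1)
    {t : ℝ} (ht : 0 ≤ t) {f g : E d → Z} (hf : Continuous f) (hg : Continuous g) {C D : ℝ}
    (hC : ∀ x, ‖f x‖ ≤ C) (hD : ∀ x, ‖g x‖ ≤ D) (x : E d) :
    S σ β t (fun y => f y - g y) x = S σ β t f x - S σ β t g x := by
  have := isProbabilityMeasure_stableMeasure (d := d) hβ hβ'
  simp_rw [S_eq_avg hσ hβ hβ' ht]
  exact avg_sub hf hg hC hD _ _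

end Propagator

/-! ### Recovering the periodic part at infinity -/

section Periodic

variable {d : ℕ}

theorem tendsto_add_nsmul_cocompact {g : E d} (hg : g ≠ 0) (x : E d) :
    Tendsto (fun n : ℕ => x + (n : ℤ) • g) atTop (cocompact (E d)) := by
  rw [← Metric.cobounded_eq_cocompact]
  refine (_root_.tendsto_const_add_cobounded x).comp ?_
  rw [← tendsto_norm_atTop_iff_cobounded]
  have h : ∀ n : ℕ, ‖(n : ℤ) • g‖ = (n : ℝ) * ‖g‖ := fun n => by
    rw [← Int.cast_smul_eq_zsmul ℝ, norm_smul]; simp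
  simp_rw [h]
  exact tendsto_natCast_atTop_atTop.atTop_mul_const (norm_pos_iff.mpr hg)

/-- Along multiples of a nonzero period `a`, f(x + na) tends to g(x). This is what makes the
periodic solution inherit a priori bounds from the full one. -/
theorem norm_le_of_sub_mem_CZero {Z : Type*} [NormedAddCommGroup Z] [NormedSpace ℝ Z]
    {Γ : Submodule ℤ (E d)} (hΓ : Γ ≠ ⊥) {f g : E d →ᵇ Z}
    (hg : g ∈ CuPer Z Γ) (hfg : f - g ∈ CZero d Z) : ‖g‖ ≤ ‖f‖ := by
  obtain ⟨a, ha, ha0⟩ := Submodule.exists_mem_ne_zero_of_ne_bot hΓ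
  refine (BoundedContinuousFunction.norm_le (norm_nonneg _)).2 fun x => ?_
  have h1 : Tendsto (fun n : ℕ => f (x + (n : ℤ) • a) - g (x + (n : ℤ) • a)) atTop (𝓝 0) :=
    Tendsto.comp hfg (tendsto_add_nsmul_cocompact ha0 x)
  have h2 : ∀ n : ℕ, g (x + (n : ℤ) • a) = g x := fun n => hg.2 _ (Γ.smul_mem _ ha) x
  simp_rw [h2] at h1
  have h3 := h1.add_const (g x)
  simp only [sub_add_cancel, zero_add] at h3
  exact le_of_tendsto' h3.norm fun n => f.norm_coe_le_norm _

end Periodic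

/-! ### Half-open time intervals -/

section TimeInterval

theorem Icc_subset_timeInterval {T : ℝ≥0∞} {t : ℝ} (ht : t ∈ timeInterval T) :
    Icc 0 t ⊆ timeInterval T := fun _ hs =>
  ⟨hs.1, (ENNReal.ofReal_le_ofReal hs.2).trans_lt ht.2⟩

theorem timeInterval_mono {T T' : ℝ≥0∞} (h : T ≤ T') : timeInterval T ⊆ timeInterval T' :=
  fun _ ht => ⟨ht.1, ht.2.trans_le h⟩

theorem mem_timeInterval_ofReal {a t : ℝ} :
    t ∈ timeInterval (ENNReal.ofReal a) ↔ 0 ≤ t ∧ t < a := by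
  refine and_congr_right fun ht => ?_
  rw [ENNReal.ofReal_lt_ofReal_iff']
  exact ⟨fun h => h.1, fun h => ⟨h, ht.trans_lt h⟩⟩

theorem exists_lt_mem_timeInterval {T : ℝ≥0∞} {t : ℝ} (ht : t ∈ timeInterval T) :
    ∃ t', t < t' ∧ t' ∈ timeInterval T := by
  obtain ⟨a, h1, h2⟩ := exists_between ht.2
  have ha : a ≠ ⊤ := (h2.trans_le le_top).ne
  have h3 : t < a.toReal := by
    rwa [← ENNReal.ofReal_toReal ha, ENNReal.ofReal_lt_ofReal_iff_of_nonneg ht.1] at h1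
  exact ⟨a.toReal, h3, ht.1.trans h3.le, by rwa [ENNReal.ofReal_toReal ha]⟩

end TimeInterval

/-! ### Continuity and bounds of F(s, f(·)) -/

section Nonlinearity

variable {d : ℕ} {Z : Type*} [NormedAddCommGroup Z] {F : ℝ → Z → Z}

theorem continuous_comp_nonlinearity (hF : ContinuousOn (Function.uncurry F) (Ici 0 ×ˢ univ))
    {s : ℝ} (hs : 0 ≤ s) (f : E d →ᵇ Z) : Continuous fun y => F s (f y) :=
  hF.comp_continuous (f := fun y => (s, f y)) (by fun_prop) fun _ => ⟨hs, mem_univ _⟩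

theorem LocallyLipschitzSnd.exists_bound (hFL : LocallyLipschitzSnd F) {s : ℝ} (hs : 0 ≤ s)
    (f : E d →ᵇ Z) : ∃ C, ∀ y, ‖F s (f y)‖ ≤ C := by
  obtain ⟨L, hL, h⟩ := hFL (‖f‖ + 1) (by positivity) (s + 1) (by positivity)
  refine ⟨L * ‖f‖ + ‖F s 0‖, fun y => ?_⟩
  have hy := f.norm_coe_le_norm y
  have h1 := h s ⟨hs, by linarith⟩ (f y) 0 (by linarith) (by rw [norm_zero]; positivity)
  rw [sub_zero] at h1
  exact (norm_le_norm_sub_add (F s (f y)) (F s 0)).trans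
    (add_le_add_left (h1.trans (mul_le_mul_of_nonneg_left hy hL.le)) _)

end Nonlinearity

/-! ### Mild solutions: uniqueness, maximality and splitting -/

section Mild

variable {d : ℕ} {Z : Type*} [NormedAddCommGroup Z] [NormedSpace ℝ Z] {σ β : ℝ}
  {N : ℝ → E d → Z → Z} {F : ℝ → Z → Z} {u₀ v₀ w₀ : E d →ᵇ Z} {T T' : ℝ≥0∞}
  {u v w : ℝ → E d →ᵇ Z}

theorem IsMildSolution.mono (h : IsMildSolution σ β N u₀ T u) (hT : T' ≤ T) :
    IsMildSolution σ β N u₀ T' u :=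
  ⟨fun t ht => h.mem_Cu t (timeInterval_mono hT ht), h.continuousOn.mono (timeInterval_mono hT),
    fun t ht => h.integrable t (timeInterval_mono hT ht),
    fun t ht => h.mild t (timeInterval_mono hT ht)⟩

theorem IsMildSolution.congr (h : IsMildSolution σ β N u₀ T u)
    (huv : EqOn v u (timeInterval T)) : IsMildSolution σ β N u₀ T v := by
  have key : ∀ t ∈ timeInterval T, ∀ x, ∀ s ∈ uIcc 0 t,
      S σ β (t - s) (fun y => N s y (v s y)) x = S σ β (t - s) (fun y => N s y (u s y)) x := by
    intro t ht x s hs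
    rw [uIcc_of_le ht.1] at hs
    rw [huv (Icc_subset_timeInterval ht hs)]
  refine ⟨fun t ht => huv ht ▸ h.mem_Cu t ht, h.continuousOn.congr huv, fun t ht x => ?_,
    fun t ht x => ?_⟩
  · exact (h.integrable t ht x).congr fun s hs => (key t ht x s (uIoc_subset_uIcc hs)).symm
  · rw [huv ht, h.mild t ht x, intervalIntegral.integral_congr (key t ht x)]

/-- Every requirement except continuity concerns a single time `t`; continuity is local because [0,
T') is relatively open in the nonnegative times. -/
theorem IsMildSolution.of_local (h : ∀ t ∈ timeInterval T, ∃ T', t ∈ timeInterval T' ∧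
    IsMildSolution σ β N u₀ T' u) : IsMildSolution σ β N u₀ T u := by
  refine ⟨fun t ht => ?_, fun t ht => ?_, fun t ht => ?_, fun t ht => ?_⟩
  all_goals obtain ⟨T', ht', h'⟩ := h t ht
  · exact h'.mem_Cu t ht'
  · refine (h'.continuousOn t ht').mono_of_mem_nhdsWithin ?_
    have ho : IsOpen {s : ℝ | ENNReal.ofReal s < T'} :=
      isOpen_lt ENNReal.continuous_ofReal continuous_const
    filter_upwards [self_mem_nhdsWithin, mem_nhdsWithin_of_mem_nhds (ho.mem_nhds ht'.2)]
      with s hs hs'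
    exact ⟨hs.1, hs'⟩
  · exact h'.integrable t ht'
  · exact h'.mild t ht'

theorem IsMildSolution.exists_bound (hu : IsMildSolution σ β N u₀ T u) {a : ℝ}
    (ha : a ∈ timeInterval T) : ∃ R > 0, ∀ t ∈ Icc 0 a, ‖u t‖ ≤ R := by
  obtain ⟨R, hR⟩ := isCompact_Icc.exists_bound_of_continuousOn
    (hu.continuousOn.mono (Icc_subset_timeInterval ha))
  exact ⟨max R 1, by positivity, fun t ht => (hR t ht).trans (le_max_left _ _)⟩

variable [NeZero d] [CompleteSpace Z]

/-- The difference of two solutions solves the perturbation equation. -/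
theorem IsMildSolution.sub (hσ : 0 ≤ σ) (hβ : 0 < β) (hβ' : β ≤ 1)
    (hF : ContinuousOn (Function.uncurry F) (Ici 0 ×ˢ univ)) (hFL : LocallyLipschitzSnd F)
    (hu : IsMildSolution σ β (fun t _ z => F t z) u₀ T u)
    (hv : IsMildSolution σ β (fun t _ z => F t z) v₀ T v) :
    IsMildSolution σ β (fun t x z => F t (v t x + z) - F t (v t x)) (u₀ - v₀) T
      (fun t => u t - v t) := by
  have key : ∀ t ∈ timeInterval T, ∀ x, ∀ s ∈ uIcc 0 t,
      S σ β (t - s) (fun y => F s (v s y + (u s - v s) y) - F s (v s y)) x =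
      S σ β (t - s) (fun y => F s (u s y)) x - S σ β (t - s) (fun y => F s (v s y)) x := by
    intro t ht x s hs
    rw [uIcc_of_le ht.1] at hs
    obtain ⟨C, hC⟩ := hFL.exists_bound hs.1 (u s)
    obtain ⟨D, hD⟩ := hFL.exists_bound hs.1 (v s)
    rw [← S_sub hσ hβ hβ' (sub_nonneg.2 hs.2) (continuous_comp_nonlinearity hF hs.1 (u s))
      (continuous_comp_nonlinearity hF hs.1 (v s)) hC hD]
    congr 2
    ext y
    simp
  refine ⟨fun t ht => (Cu d Z).sub_mem (hu.mem_Cu t ht) (hv.mem_Cu t ht),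
    hu.continuousOn.sub hv.continuousOn, fun t ht x => ?_, fun t ht x => ?_⟩
  · exact ((hu.integrable t ht x).sub (hv.integrable t ht x)).congr fun s hs =>
      (key t ht x s (uIoc_subset_uIcc hs)).symm
  · rw [intervalIntegral.integral_congr (key t ht x),
      intervalIntegral.integral_sub (hu.integrable t ht x) (hv.integrable t ht x),
      BoundedContinuousFunction.sub_apply, hu.mild t ht x, hv.mild t ht x,
      BoundedContinuousFunction.coe_sub]
    have h := S_sub hσ hβ hβ' ht.1 u₀.continuous v₀.continuous u₀.norm_coe_le_norm
      v₀.norm_coe_le_norm x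
    rw [show (⇑u₀ - ⇑v₀) = fun y => u₀ y - v₀ y from rfl, h]
    abel

/-- A solution plus a solution of the perturbation equation is a solution. -/
theorem IsMildSolution.add (hσ : 0 ≤ σ) (hβ : 0 < β) (hβ' : β ≤ 1)
    (hF : ContinuousOn (Function.uncurry F) (Ici 0 ×ˢ univ)) (hFL : LocallyLipschitzSnd F)
    (hv : IsMildSolution σ β (fun t _ z => F t z) v₀ T v)
    (hw : IsMildSolution σ β (fun t x z => F t (v t x + z) - F t (v t x)) w₀ T w) :
    IsMildSolution σ β (fun t _ z => F t z) (v₀ + w₀) T (fun t => v t + w t) := by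
  have key : ∀ t ∈ timeInterval T, ∀ x, ∀ s ∈ uIcc 0 t,
      S σ β (t - s) (fun y => F s ((v s + w s) y)) x =
      S σ β (t - s) (fun y => F s (v s y)) x +
      S σ β (t - s) (fun y => F s (v s y + w s y) - F s (v s y)) x := by
    intro t ht x s hs
    rw [uIcc_of_le ht.1] at hs
    obtain ⟨C, hC⟩ := hFL.exists_bound hs.1 (v s + w s)
    obtain ⟨D, hD⟩ := hFL.exists_bound hs.1 (v s)
    have h := S_sub hσ hβ hβ' (sub_nonneg.2 hs.2)
      (continuous_comp_nonlinearity hF hs.1 (v s + w s))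
      (continuous_comp_nonlinearity hF hs.1 (v s)) hC hD x
    simp only [BoundedContinuousFunction.add_apply] at h ⊢
    rw [h]
    abel
  refine ⟨fun t ht => (Cu d Z).add_mem (hv.mem_Cu t ht) (hw.mem_Cu t ht),
    hv.continuousOn.add hw.continuousOn, fun t ht x => ?_, fun t ht x => ?_⟩
  · exact ((hv.integrable t ht x).add (hw.integrable t ht x)).congr fun s hs =>
      (key t ht x s (uIoc_subset_uIcc hs)).symm
  · rw [intervalIntegral.integral_congr (key t ht x),
      intervalIntegral.integral_add (hv.integrable t ht x) (hw.integrable t ht x),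
      BoundedContinuousFunction.add_apply, hv.mild t ht x, hw.mild t ht x]
    have h := S_add hσ hβ hβ' ht.1 v₀.continuous w₀.continuous v₀.norm_coe_le_norm
      w₀.norm_coe_le_norm x
    rw [show (⇑(v₀ + w₀)) = fun y => v₀ y + w₀ y from rfl, h]
    abel

/-- A mild solution bounded by `R` on `[0, a]` solves the integral equation with the nonlinearity
cut off at `R`. -/
theorem IsMildSolution.exists_isVolterra (hσ : 0 ≤ σ) (hβ : 0 < β) (hβ' : β ≤ 1)
    (hu : IsMildSolution σ β (fun t _ z => F t z) u₀ T u) {a : ℝ} (ha : a ∈ timeInterval T)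
    {R : ℝ} (hR : 0 < R) (hb : ∀ t ∈ Icc 0 a, ‖u t‖ ≤ R) :
    ∃ U : ℝ →ᵇ Cu d Z, IsVolterra (stableMeasure d β) (scale σ β) a (cutoff F a R) u₀ U ∧
      ∀ t ∈ Icc 0 a, (U t : E d →ᵇ Z) = u t := by
  have hsub := Icc_subset_timeInterval ha
  have hm : ∀ t, clip a t ∈ Icc 0 a := clip_mem ha.1
  let U' : ℝ → Cu d Z := fun t => ⟨u (clip a t), hu.mem_Cu _ (hsub (hm t))⟩
  have hU' : Continuous U' := Continuous.subtype_mk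
    (hu.continuousOn.comp_continuous (continuous_clip a) fun t => hsub (hm t)) _
  let U : ℝ →ᵇ Cu d Z := BoundedContinuousFunction.ofNormedAddCommGroup U' hU' R
    fun t => hb _ (hm t)
  have hUv : ∀ t, (U t : E d →ᵇ Z) = u (clip a t) := fun t => rfl
  refine ⟨U, fun t x => ?_, fun t ht => ?_⟩
  · rw [hUv, hu.mild _ (hsub (hm t)), S_eq_avg hσ hβ hβ' (hm t).1, duhamel]
    congr 1
    refine intervalIntegral.integral_congr fun s hs => ?_
    rw [uIcc_of_le (hm t).1] at hs
    have hs' : s ∈ Icc 0 a := ⟨hs.1, hs.2.trans (hm t).2⟩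
    rw [S_eq_avg hσ hβ hβ' (sub_nonneg.2 hs.2)]
    congr 1
    ext y
    rw [source, hUv, clip_of_mem hs',
      cutoff_eq F hs' hR (((u s).norm_coe_le_norm y).trans (hb s hs'))]
  · rw [hUv, clip_of_mem ht]

/-- A solution of the cut-off integral equation is a mild solution as long as it stays bounded by
the cut-off radius. -/
theorem IsVolterra.isMildSolution (hσ : 0 ≤ σ) (hβ : 0 < β) (hβ' : β ≤ 1)
    (hF : ContinuousOn (Function.uncurry F) (Ici 0 ×ˢ univ)) (hFL : LocallyLipschitzSnd F)
    {a b R : ℝ} (hab : b ≤ a) (ha : 0 ≤ a) (hR : 0 < R) {U : ℝ →ᵇ Cu d Z}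
    (hU : IsVolterra (stableMeasure d β) (scale σ β) a (cutoff F a R) u₀ U)
    (hb : ∀ t, 0 ≤ t → t < b → ‖U t‖ ≤ R) :
    IsMildSolution σ β (fun t _ z => F t z) u₀ (ENNReal.ofReal b) (fun t => (U t : E d →ᵇ Z)) := by
  have := isProbabilityMeasure_stableMeasure (d := d) hβ hβ'
  obtain ⟨C, L, hG⟩ := exists_isTame_cutoff hF hFL ha hR
  have key : ∀ t ∈ timeInterval (ENNReal.ofReal b), ∀ x, ∀ s ∈ uIcc 0 t,
      S σ β (t - s) (fun y => F s ((U s : E d →ᵇ Z) y)) x =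
      avg (stableMeasure d β) (scale σ β (t - s)) (source (cutoff F a R) U s) x := by
    intro t ht x s hs
    rw [uIcc_of_le ht.1] at hs
    have htb := (mem_timeInterval_ofReal.1 ht).2
    rw [S_eq_avg hσ hβ hβ' (sub_nonneg.2 hs.2)]
    congr 1
    ext y
    rw [source, cutoff_eq F ⟨hs.1, by linarith [hs.2]⟩ hR]
    exact ((U s : E d →ᵇ Z).norm_coe_le_norm y).trans (hb s hs.1 (hs.2.trans_lt htb))
  refine ⟨fun t _ => (U t).2, (continuous_subtype_val.comp U.continuous).continuousOn,
    fun t ht x => ?_, fun t ht x => ?_⟩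
  · exact ((continuous_duhamel_integrand (continuous_scale σ hβ) (hG.continuous_source U) (C := C)
      (fun s y => hG.bound _ _) t x).intervalIntegrable 0 t).congr fun s hs =>
      (key t ht x s (uIoc_subset_uIcc hs)).symm
  · have htb := mem_timeInterval_ofReal.1 ht
    rw [intervalIntegral.integral_congr (key t ht x), hU t x,
      clip_of_mem ⟨htb.1, by linarith [htb.2]⟩, S_eq_avg hσ hβ hβ' ht.1, duhamel]

/-- On [0, t] both solutions are bounded; with a cutoff radius above both bounds they solve the same
tame equation, whose solution is unique. -/
theorem IsMildSolution.eq (hσ : 0 ≤ σ) (hβ : 0 < β) (hβ' : β ≤ 1)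
    (hF : ContinuousOn (Function.uncurry F) (Ici 0 ×ˢ univ)) (hFL : LocallyLipschitzSnd F)
    (hu₀ : u₀ ∈ Cu d Z) (hu : IsMildSolution σ β (fun t _ z => F t z) u₀ T u)
    (hv : IsMildSolution σ β (fun t _ z => F t z) u₀ T' v) {t : ℝ} (ht : t ∈ timeInterval T)
    (ht' : t ∈ timeInterval T') : u t = v t := by
  have := isProbabilityMeasure_stableMeasure (d := d) hβ hβ'
  obtain ⟨R, hR, hb⟩ := hu.exists_bound ht
  obtain ⟨R', hR', hb'⟩ := hv.exists_bound ht'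
  have hM : 0 < max R R' := lt_max_of_lt_left hR
  obtain ⟨C, L, hG⟩ := exists_isTame_cutoff hF hFL ht.1 hM
  obtain ⟨U, hU, hUu⟩ := hu.exists_isVolterra hσ hβ hβ' ht hM
    fun s hs => (hb s hs).trans (le_max_left _ _)
  obtain ⟨V, hV, hVv⟩ := hv.exists_isVolterra hσ hβ hβ' ht' hM
    fun s hs => (hb' s hs).trans (le_max_right _ _)
  have htm : t ∈ Icc 0 t := ⟨ht.1, le_rfl⟩
  rw [← hUu t htm, ← hVv t htm, hU.unique hG (continuous_scale σ hβ) ht.1 hu₀ hV]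

/-- The solution with cutoff radius ‖u₀‖ + 1 starts at `u₀`, so by continuity the cutoff is inactive
for a short time. -/
theorem maxTime_pos (hσ : 0 ≤ σ) (hβ : 0 < β) (hβ' : β ≤ 1)
    (hF : ContinuousOn (Function.uncurry F) (Ici 0 ×ˢ univ)) (hFL : LocallyLipschitzSnd F)
    (hu₀ : u₀ ∈ Cu d Z) : 0 < maxTime σ β F u₀ := by
  have := isProbabilityMeasure_stableMeasure (d := d) hβ hβ'
  have hR : 0 < ‖u₀‖ + 1 := by positivity
  obtain ⟨C, L, hG⟩ := exists_isTame_cutoff hF hFL zero_le_one hR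
  obtain ⟨U, hU⟩ := hG.exists_isVolterra (μ := stableMeasure d β) (continuous_scale σ hβ)
    zero_le_one hu₀
  have h0 : (U 0 : E d →ᵇ Z) = u₀ := by
    ext x
    rw [hU, clip_of_mem ⟨le_rfl, zero_le_one⟩, scale, max_self, mul_zero,
      Real.zero_rpow (by positivity), avg_zero, duhamel, intervalIntegral.integral_same, add_zero]
  have h1 : ∀ᶠ t in 𝓝 (0 : ℝ), ‖U t‖ < ‖u₀‖ + 1 := by
    refine U.continuous.norm.continuousAt.eventually (gt_mem_nhds ?_)
    have h : ‖U 0‖ = ‖u₀‖ := by rw [← h0, Submodule.coe_norm]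
    change ‖U 0‖ < ‖u₀‖ + 1
    linarith
  obtain ⟨δ, hδ, h2⟩ := Metric.eventually_nhds_iff.1 h1
  have h3 := hU.isMildSolution hσ hβ hβ' hF hFL (min_le_right δ 1) zero_le_one hR
    fun t ht ht' => (h2 (by
      rw [Real.dist_0_eq_abs, abs_of_nonneg ht]
      exact ht'.trans_le (min_le_left _ _))).le
  refine lt_of_lt_of_le (ENNReal.ofReal_pos.2 (lt_min hδ one_pos)) (le_sSup ⟨_, h3⟩)

/-- At each time the value is taken from any solution defined there, and `IsMildSolution.eq` makes
the choice irrelevant. As intervals are half-open, each time before the supremum lies in the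
interval of some solution, so the supremum is attained. -/
theorem exists_maximal_solution (hσ : 0 ≤ σ) (hβ : 0 < β) (hβ' : β ≤ 1)
    (hF : ContinuousOn (Function.uncurry F) (Ici 0 ×ˢ univ)) (hFL : LocallyLipschitzSnd F)
    (hu₀ : u₀ ∈ Cu d Z) : ∃ u,
      IsMildSolution σ β (fun t _ z => F t z) u₀ (maxTime σ β F u₀) u ∧
      ∀ T u', IsMildSolution σ β (fun t _ z => F t z) u₀ T u' → EqOn u' u (timeInterval T) := by
  classical
  let u : ℝ → E d →ᵇ Z := fun t =>
    if h : ∃ u', ∃ T, t ∈ timeInterval T ∧ IsMildSolution σ β (fun t _ z => F t z) u₀ T u' then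
      h.choose t else 0
  have hu : ∀ T u', IsMildSolution σ β (fun t _ z => F t z) u₀ T u' →
      EqOn u' u (timeInterval T) := by
    intro T u' h t ht
    have hex : ∃ u', ∃ T, t ∈ timeInterval T ∧
      IsMildSolution σ β (fun t _ z => F t z) u₀ T u' := ⟨u', T, ht, h⟩
    obtain ⟨T₁, ht₁, h₁⟩ := hex.choose_spec
    simp only [u, dif_pos hex]
    exact h.eq hσ hβ hβ' hF hFL hu₀ h₁ ht ht₁
  refine ⟨u, IsMildSolution.of_local fun t ht => ?_, hu⟩
  obtain ⟨T, ⟨u', hu'⟩, hT⟩ := lt_sSup_iff.1 ht.2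
  exact ⟨T, ⟨ht.1, hT⟩, hu'.congr (hu T u' hu').symm⟩

/-- As long as the solution from `u₀` exists, so does the solution from the periodic part of
`u₀`, and their difference vanishes at infinity. -/
theorem IsMildSolution.exists_periodic_part (hσ : 0 ≤ σ) (hβ : 0 < β) (hβ' : β ≤ 1)
    (hF : ContinuousOn (Function.uncurry F) (Ici 0 ×ˢ univ)) (hFL : LocallyLipschitzSnd F)
    {Γ : Submodule ℤ (E d)} (hΓ : Γ ≠ ⊥) (hv₀ : v₀ ∈ CuPer Z Γ) (hu₀ : u₀ - v₀ ∈ CZero d Z)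
    (hu : IsMildSolution σ β (fun t _ z => F t z) u₀ T u) {a : ℝ} (ha : a ∈ timeInterval T) :
    ∃ v, IsMildSolution σ β (fun t _ z => F t z) v₀ (ENNReal.ofReal a) v ∧
      ∀ t ∈ timeInterval (ENNReal.ofReal a), v t ∈ CuPer Z Γ ∧ u t - v t ∈ CZero d Z := by
  have := isProbabilityMeasure_stableMeasure (d := d) hβ hβ'
  have hr := continuous_scale σ hβ
  obtain ⟨R, hR, hb⟩ := hu.exists_bound ha
  obtain ⟨C, L, hG⟩ := exists_isTame_cutoff hF hFL ha.1 hR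
  have hu₀' : u₀ ∈ Cu d Z := by
    rw [← sub_add_cancel u₀ v₀]
    exact (Cu d Z).add_mem (CZero_le_Cu hu₀) hv₀.1
  obtain ⟨U, hU, hUu⟩ := hu.exists_isVolterra hσ hβ hβ' ha hR hb
  obtain ⟨V, hV⟩ := hG.exists_isVolterra (μ := stableMeasure d β) hr ha.1 hv₀.1
  have hVper := hV.mem_CuPer hG hr ha.1 hv₀
  have hUV := hU.sub_mem_CZero hG hr ha.1 hu₀' hv₀.1 hu₀ hV
  refine ⟨fun t => V t, hV.isMildSolution hσ hβ hβ' hF hFL le_rfl ha.1 hR fun t ht hta => ?_,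
    fun t ht => ⟨hVper t, ?_⟩⟩
  · have htm : t ∈ Icc 0 a := ⟨ht, hta.le⟩
    -- `V` is built with the cutoff radius `R` of `u`. Its norm is at most that of `U`, so the
    -- cutoff is never active and no continuation criterion is needed.
    refine (norm_le_of_sub_mem_CZero hΓ (hVper t) (hUV t)).trans ?_
    rw [hUu t htm]
    exact hb t htm
  · rw [mem_timeInterval_ofReal] at ht
    rw [← hUu t ⟨ht.1, ht.2.le⟩]
    exact hUV t

/-- `IsMildSolution.exists_periodic_part` only reaches times strictly before `a`, hence the choice
of an `a` beyond `t`; uniqueness then identifies its solution with `v`. -/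
theorem IsMildSolution.sub_mem_CZero (hσ : 0 ≤ σ) (hβ : 0 < β) (hβ' : β ≤ 1)
    (hF : ContinuousOn (Function.uncurry F) (Ici 0 ×ˢ univ)) (hFL : LocallyLipschitzSnd F)
    {Γ : Submodule ℤ (E d)} (hΓ : Γ ≠ ⊥) (hv₀ : v₀ ∈ CuPer Z Γ) (hu₀ : u₀ - v₀ ∈ CZero d Z)
    (hu : IsMildSolution σ β (fun t _ z => F t z) u₀ T u)
    (hv : ∀ T v', IsMildSolution σ β (fun t _ z => F t z) v₀ T v' → EqOn v' v (timeInterval T))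
    {t : ℝ} (ht : t ∈ timeInterval T) : v t ∈ CuPer Z Γ ∧ u t - v t ∈ CZero d Z := by
  obtain ⟨a, hta, ha⟩ := exists_lt_mem_timeInterval ht
  obtain ⟨v', hv', h⟩ := hu.exists_periodic_part hσ hβ hβ' hF hFL hΓ hv₀ hu₀ ha
  have htm := mem_timeInterval_ofReal.2 ⟨ht.1, hta⟩
  rw [← hv _ _ hv' htm]
  exact h t htm

theorem maxTime_le_maxTime (hσ : 0 ≤ σ) (hβ : 0 < β) (hβ' : β ≤ 1)
    (hF : ContinuousOn (Function.uncurry F) (Ici 0 ×ˢ univ)) (hFL : LocallyLipschitzSnd F)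
    {Γ : Submodule ℤ (E d)} (hΓ : Γ ≠ ⊥) (hv₀ : v₀ ∈ CuPer Z Γ) (hu₀ : u₀ - v₀ ∈ CZero d Z)
    (hu : IsMildSolution σ β (fun t _ z => F t z) u₀ (maxTime σ β F u₀) u) :
    maxTime σ β F u₀ ≤ maxTime σ β F v₀ := by
  refine le_of_forall_lt_imp_le_of_dense fun a ha => ?_
  have hatop : a ≠ ⊤ := (ha.trans_le le_top).ne
  obtain ⟨v, hv, -⟩ := hu.exists_periodic_part hσ hβ hβ' hF hFL hΓ hv₀ hu₀ (a := a.toReal)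
    ⟨ENNReal.toReal_nonneg, by rwa [ENNReal.ofReal_toReal hatop]⟩
  rw [ENNReal.ofReal_toReal hatop] at hv
  exact le_sSup ⟨v, hv⟩

end Mild

end FracRD

end

theorem mainTheorem1 {d q : ℕ} {Z : Type*} [NormedAddCommGroup Z] [NormedSpace ℝ Z]
    [CompleteSpace Z] (σ β : ℝ) (hσ : 0 ≤ σ) (hβ : 0 < β) (hβ' : β ≤ 1)
    (hq : 1 ≤ q) (γ : Fin q → FracRD.E d) (hγ : LinearIndependent ℝ γ)
    (F : ℝ → Z → Z) (hF : ContinuousOn (Function.uncurry F) (Set.Ici 0 ×ˢ Set.univ))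
    (hFL : FracRD.LocallyLipschitzSnd F)
    (u₀ : BoundedContinuousFunction (FracRD.E d) Z)
    (hu₀ : u₀ ∈ FracRD.XSpace Z (FracRD.lattice γ)) :
    0 < FracRD.maxTime σ β F u₀ ∧
    ∃ u : ℝ → BoundedContinuousFunction (FracRD.E d) Z,
      -- `u` is the mild solution with initial data `u₀` on its maximal interval
      FracRD.IsMildSolution σ β (fun t _ z => F t z) u₀ (FracRD.maxTime σ β F u₀) u ∧
      (∀ T u', FracRD.IsMildSolution σ β (fun t _ z => F t z) u₀ T u' →
        Set.EqOn u' u (FracRD.timeInterval T)) ∧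
      -- it stays in `X_{Γ,Z}`
      (∀ t ∈ FracRD.timeInterval (FracRD.maxTime σ β F u₀),
        u t ∈ FracRD.XSpace Z (FracRD.lattice γ)) ∧
      -- and it splits
      ∀ v₀ ∈ FracRD.CuPer Z (FracRD.lattice γ), ∀ w₀ ∈ FracRD.CZero d Z, u₀ = v₀ + w₀ →
        FracRD.maxTime σ β F u₀ ≤ FracRD.maxTime σ β F v₀ ∧
        ∃ v w : ℝ → BoundedContinuousFunction (FracRD.E d) Z,
          FracRD.IsMildSolution σ β (fun t _ z => F t z) v₀ (FracRD.maxTime σ β F v₀) v ∧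
          (∀ T v', FracRD.IsMildSolution σ β (fun t _ z => F t z) v₀ T v' →
            Set.EqOn v' v (FracRD.timeInterval T)) ∧
          (∀ t ∈ FracRD.timeInterval (FracRD.maxTime σ β F v₀),
            v t ∈ FracRD.CuPer Z (FracRD.lattice γ)) ∧
          FracRD.IsMildSolution σ β (fun t x z => F t (v t x + z) - F t (v t x)) w₀
            (FracRD.maxTime σ β F u₀) w ∧
          (∀ T w', T ≤ FracRD.maxTime σ β F u₀ →
            FracRD.IsMildSolution σ β (fun t x z => F t (v t x + z) - F t (v t x)) w₀ T w' →
            Set.EqOn w' w (FracRD.timeInterval T)) ∧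
          ∀ t ∈ FracRD.timeInterval (FracRD.maxTime σ β F u₀),
            w t ∈ FracRD.CZero d Z ∧ u t = v t + w t := by

  have hγ0 : γ ⟨0, hq⟩ ≠ 0 := hγ.ne_zero _
  -- A nonzero period exists, which forces d ≥ 1 and makes Γ nontrivial.
  have hd : NeZero d := ⟨by
    rintro rfl
    exact hγ0 (Subsingleton.elim _ _)⟩
  have hΓ : FracRD.lattice γ ≠ ⊥ := (Submodule.ne_bot_iff _).2
    ⟨_, Submodule.subset_span (Set.mem_range_self _), hγ0⟩
  have hX : ∀ v₀ ∈ FracRD.CuPer Z (FracRD.lattice γ), ∀ w₀ ∈ FracRD.CZero d Z,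
      u₀ = v₀ + w₀ → u₀ ∈ FracRD.Cu d Z ∧ u₀ - v₀ ∈ FracRD.CZero d Z := by
    rintro v₀ hv₀ w₀ hw₀ rfl
    exact ⟨(FracRD.Cu d Z).add_mem hv₀.1 (FracRD.CZero_le_Cu hw₀), by
      rwa [add_sub_cancel_left]⟩
  obtain ⟨v₁, hv₁, w₁, hw₁, h₁⟩ := Submodule.mem_sup.1 hu₀
  have hu₀' := (hX v₁ hv₁ w₁ hw₁ h₁.symm).1
  obtain ⟨u, hu, hu'⟩ := FracRD.exists_maximal_solution hσ hβ hβ' hF hFL hu₀'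
  refine ⟨FracRD.maxTime_pos hσ hβ hβ' hF hFL hu₀', u, hu, hu', fun t ht => ?_,
    fun v₀ hv₀ w₀ hw₀ h₀ => ?_⟩
  · obtain ⟨v, -, hv'⟩ := FracRD.exists_maximal_solution hσ hβ hβ' hF hFL hv₁.1
    obtain ⟨h2, h3⟩ := hu.sub_mem_CZero hσ hβ hβ' hF hFL hΓ hv₁ (hX v₁ hv₁ w₁ hw₁ h₁.symm).2 hv' ht
    exact Submodule.mem_sup.2 ⟨_, h2, _, h3, add_sub_cancel _ _⟩
  · have hsub := (hX v₀ hv₀ w₀ hw₀ h₀).2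
    have hw₀' : u₀ - v₀ = w₀ := by rw [h₀, add_sub_cancel_left]
    have hle := FracRD.maxTime_le_maxTime hσ hβ hβ' hF hFL hΓ hv₀ hsub hu
    obtain ⟨v, hv, hv'⟩ := FracRD.exists_maximal_solution hσ hβ hβ' hF hFL hv₀.1
    refine ⟨hle, v, fun t => u t - v t, hv, hv', fun t ht => ?_, ?_, fun T w' hT hw' t ht => ?_,
      fun t ht => ⟨?_, (add_sub_cancel _ _).symm⟩⟩
    -- The splitting applied to `v` itself, with zero decaying part, gives periodicity up to the
    -- possibly larger time T*(v₀).
    · exact (hv.sub_mem_CZero hσ hβ hβ' hF hFL hΓ hv₀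
        (by rw [sub_self]; exact Submodule.zero_mem _) hv' ht).1
    · rw [← hw₀']
      exact hu.sub hσ hβ hβ' hF hFL (hv.mono hle)
    -- Adding `v` turns a competing solution of the perturbed problem into a solution from `u₀`,
    -- where uniqueness is known.
    · have h := (hv.mono (hT.trans hle)).add hσ hβ hβ' hF hFL hw'
      rw [← h₀] at h
      simp only
      rw [← hu' T _ h ht, add_sub_cancel_left]
    · exact (hu.sub_mem_CZero hσ hβ hβ' hF hFL hΓ hv₀ hsub hv' ht).2
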